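/- Let $0\le k,m\le n$, let $\lambda$ be a partition whose Young diagram lies in the $k\times(n-k)$ rectangle and $\mu$ a partition whose Young diagram lies in the $m\times(n-m)$ rectangle. For $1\le i\le n$ put $s_i(\lambda)=1$ if $i\in\{\lambda_k+1,\lambda_{k-1}+2,\dots,\lambda_1+k\}$ and $s_i(\lambda)=0$ otherwise; put $s_i(\mu)=1$ if $i\in\{\mu_m+1,\mu_{m-1}+2,\dots,\mu_1+m\}$ and $s_i(\mu)=0$ otherwise; and let $s_i(\lambda,\mu)=s_i(\lambda)+s_i(\mu)\in\{0,1,2\}$. Let $\mathcal I_n(\lambda,\mu)$ be the set of permutations $w\in S_n$ with $w^2=\mathrm{Id}$ such that, whenever $i<j$, $w(i)=j$ and $w(j)=i$, one has $s_i(\lambda,\mu)=0$ and $s_j(\lambda,\mu)=2$. Let $B\subset \mathrm{GL}_n(\mathbb C)$ be the group of invertible upper-triangular matrices, acting diagonally on $\mathrm{Gr}(k,n)\times\mathrm{Gr}(m,n)$, and let $e_1,\dots,e_n$ be the standard basis of $\mathbb C^n$. For $w\in\mathcal I_n(\lambda,\mu)$ let $\mathcal O^w_{\lambda\mu}$ be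 the $B$-orbit of the pair $(U,W)$, where $$U=\langle e_j\mid s_j(\lambda)=1,\ w(j)=j\rangle+\langle e_{w(j)}+e_j\mid s_j(\lambda)=1,\ w(j)\ne j\rangle,\qquad W=\langle e_j\mid s_j(\mu)=1\rangle .$$ For $i<j$ let $r_{ij}(w,\lambda,\mu)=\#\{(i',j')\mid i\le i'<j'\le j,\ w(i')=j'\}$ be the number of arcs of $w$ inside $[i,j]$. **Theorem.** For all $v,w\in\mathcal I_n(\lambda,\mu)$, one has $\mathcal O^v_{\lambda\mu}\subseteq\overline{\mathcal O^w_{\lambda\mu}}$ (closure in the Zariski topology of $\mathrm{Gr}(k,n)\times\mathrm{Gr}(m,n)$) if and only if $r_{ij}(v,\lambda,\mu)\le r_{ij}(w,\lambda,\mu)$ for all $i<j$ with $s_i(\lambda,\mu)=0$ and $s_j(\lambda,\mu)=2$. -/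

import Mathlib

noncomputable section

namespace DoubleGrassmannian

open Matrix

/-- The product `Gr(k,n) × Gr(m,n)`: pairs `(U, W)` of linear subspaces of `ℂⁿ` with
`dim U = k` and `dim W = m`. -/
@[ext]
structure DoubleGr (n k m : ℕ) where
  U : Submodule ℂ (Fin n → ℂ)
  W : Submodule ℂ (Fin n → ℂ)
  finrank_U : Module.finrank ℂ U = k
  finrank_W : Module.finrank ℂ W = m

/-! ### The Zariski topology on `Gr(k,n) × Gr(m,n)`

`Gr(k,n)` is the quotient by `GL_k` of the variety of `n × k` matrices of rank `k`, a matrix being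
sent to its column space.  Accordingly `Gr(k,n) × Gr(m,n)` carries the quotient of the Zariski
topology of the variety of pairs of matrices of full column rank, an open subvariety of the affine
space of all pairs of matrices. -/

/-- Pairs of complex matrices, of sizes `n × k` and `n × m`, with linearly independent columns. -/
structure FramePair (n k m : ℕ) where
  A : Matrix (Fin n) (Fin k) ℂ
  C : Matrix (Fin n) (Fin m) ℂ
  linInd_A : LinearIndependent ℂ A.col
  linInd_C : LinearIndependent ℂ C.col

variable {n k m : ℕ}

/-- The matrix entries, as a point of the affine space of dimension `nk + nm`. -/
def FramePair.coords (F : FramePair n k m) : (Fin n × Fin k) ⊕ (Fin n × Fin m) → ℂ :=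
  Sum.elim (fun p => F.A p.1 p.2) (fun p => F.C p.1 p.2)

/-- The pair of column spaces. -/
def FramePair.toDoubleGr (F : FramePair n k m) : DoubleGr n k m where
  U := Submodule.span ℂ (Set.range F.A.col)
  W := Submodule.span ℂ (Set.range F.C.col)
  finrank_U := by simpa using finrank_span_eq_card F.linInd_A
  finrank_W := by simpa using finrank_span_eq_card F.linInd_C

/-- The Zariski topology on frame pairs: the subspace topology from the Zariski topology of affine
space, which is itself induced from the prime spectrum of the polynomial ring. -/
instance : TopologicalSpace (FramePair n k m) :=
  TopologicalSpace.induced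
    (fun F => (MvPolynomial.pointToPoint F.coords :
      PrimeSpectrum (MvPolynomial ((Fin n × Fin k) ⊕ (Fin n × Fin m)) ℂ)))
    inferInstance

/-- The Zariski topology on `Gr(k,n) × Gr(m,n)`. -/
instance : TopologicalSpace (DoubleGr n k m) :=
  TopologicalSpace.coinduced FramePair.toDoubleGr inferInstance

/-! ### The Borel subgroup and its diagonal action -/

/-- The Borel subgroup of invertible upper-triangular matrices. -/
def borel (n : ℕ) : Subgroup (GL (Fin n) ℂ) where
  carrier := {g | (g : Matrix (Fin n) (Fin n) ℂ).BlockTriangular id}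
  one_mem' := by simpa using blockTriangular_one
  mul_mem' := fun ha hb => by simpa using BlockTriangular.mul ha hb
  inv_mem' := fun {g} hg => by
    have : Invertible (g : Matrix (Fin n) (Fin n) ℂ) := g.invertible
    simpa using blockTriangular_inv_of_blockTriangular hg

/-- The orbit of the pair `(U, W)` under `b · (U, W) = (bU, bW)`, `b` in the Borel subgroup. -/
def borelOrbit (P : DoubleGr n k m) : Set (DoubleGr n k m) :=
  {Q | ∃ b ∈ borel n,
    Q.U = P.U.map (toLin' (b : Matrix (Fin n) (Fin n) ℂ)) ∧
    Q.W = P.W.map (toLin' (b : Matrix (Fin n) (Fin n) ℂ))}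

/-! ### Young diagrams, bit strings and consistent involutions

The nodes `1, …, n` are represented by `Fin n`, so node `i` has the number `(i : ℕ) + 1`; the part
`λ_{a+1}` of a partition is `lam.rowLen a`. -/

/-- The Young diagram is contained in the rectangle with `k` rows and `l` columns. -/
def FitsIn (lam : YoungDiagram) (k l : ℕ) : Prop :=
  ∀ c ∈ lam.cells, c.1 < k ∧ c.2 < l

open Classical in
/-- The bit string `s(λ)`: `s_i(λ) = 1` if `i` occurs among the numbers
`λ_k + 1, λ_{k-1} + 2, …, λ_1 + k`, and `s_i(λ) = 0` otherwise. -/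
def bit (k : ℕ) (lam : YoungDiagram) (i : Fin n) : ℕ :=
  if ∃ a < k, (i : ℕ) + 1 = lam.rowLen a + (k - a) then 1 else 0

/-- `s_i(λ,μ) = s_i(λ) + s_i(μ)`. -/
def bitSum (k m : ℕ) (lam mu : YoungDiagram) (i : Fin n) : ℕ :=
  bit k lam i + bit m mu i

/-- `w` belongs to `I_n(λ,μ)`: it is an involution, and each of its arcs joins a node `i` with
`s_i(λ,μ) = 0` to a node `j > i` with `s_j(λ,μ) = 2`. -/
structure IsConsistent (k m : ℕ) (lam mu : YoungDiagram) (w : Equiv.Perm (Fin n)) : Prop where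
  mul_self : w * w = 1
  arc : ∀ i j : Fin n, i < j → w i = j → w j = i →
    bitSum k m lam mu i = 0 ∧ bitSum k m lam mu j = 2

/-- `r_{ij}(w)`: the number of arcs of `w` inside the interval `[i, j]`. -/
def arcCount (w : Equiv.Perm (Fin n)) (i j : Fin n) : ℕ :=
  (Finset.univ.filter fun p : Fin n × Fin n =>
    i ≤ p.1 ∧ p.1 < p.2 ∧ p.2 ≤ j ∧ w p.1 = p.2).card

/-! ### The canonical representatives and the orbits -/

/-- The standard basis vector `e_i` of `ℂⁿ`. -/
def e (i : Fin n) : Fin n → ℂ := Pi.single i 1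

/-- `⟨e_j | s_j(λ) = 1, w(j) = j⟩ + ⟨e_{w(j)} + e_j | s_j(λ) = 1, w(j) ≠ j⟩`. -/
def repU (k : ℕ) (lam : YoungDiagram) (w : Equiv.Perm (Fin n)) : Submodule ℂ (Fin n → ℂ) :=
  Submodule.span ℂ {x | ∃ j : Fin n, bit k lam j = 1 ∧ w j = j ∧ x = e j} ⊔
  Submodule.span ℂ {x | ∃ j : Fin n, bit k lam j = 1 ∧ w j ≠ j ∧ x = e (w j) + e j}

/-- `⟨e_j | s_j(μ) = 1⟩ = ⟨e_{μ_m+1}, e_{μ_{m-1}+2}, …, e_{μ_1+m}⟩`. -/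
def repW (m : ℕ) (mu : YoungDiagram) : Submodule ℂ (Fin n → ℂ) :=
  Submodule.span ℂ {x | ∃ j : Fin n, bit m mu j = 1 ∧ x = e j}

theorem card_bit (hk : k ≤ n) {lam : YoungDiagram} (h : FitsIn lam k (n - k)) :
    Fintype.card {j : Fin n // bit k lam j = 1} = k := by
  have hle : ∀ a, lam.rowLen a ≤ n - k := by
    intro a
    by_contra hc
    have := (h (a, n - k) (by
      simpa using YoungDiagram.mem_iff_lt_rowLen.2 (not_le.1 hc))).2
    simp at this
  have hpos : ∀ a : Fin k, lam.rowLen a + (k - a) - 1 < n := by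
    intro a
    have := hle a
    have := a.2
    omega
  let f : Fin k → {j : Fin n // bit k lam j = 1} := fun a =>
    ⟨⟨lam.rowLen a + (k - a) - 1, hpos a⟩, by
      have := a.2
      simp only [bit]
      rw [if_pos]
      exact ⟨a, a.2, by omega⟩⟩
  have hf : Function.Bijective f := by
    constructor
    · intro a b hab
      have h1 : lam.rowLen a + (k - a) - 1 = lam.rowLen b + (k - b) - 1 := by
        simpa [f] using hab
      have ha := a.2
      have hb := b.2
      rcases lt_trichotomy (a : ℕ) b with hlt | heq | hlt
      · have := lam.rowLen_anti _ _ hlt.le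
        omega
      · exact Fin.ext heq
      · have := lam.rowLen_anti _ _ hlt.le
        omega
    · rintro ⟨j, hj⟩
      have : ∃ a < k, (j : ℕ) + 1 = lam.rowLen a + (k - a) := by
        by_contra hc
        simp [bit, hc] at hj
      obtain ⟨a, ha, hja⟩ := this
      refine ⟨⟨a, ha⟩, ?_⟩
      apply Subtype.ext
      apply Fin.ext
      simp only [f]
      omega
  simpa using (Fintype.card_of_bijective hf).symm

theorem finrank_repW (hm : m ≤ n) {mu : YoungDiagram} (h : FitsIn mu m (n - m)) :
    Module.finrank ℂ (repW m mu : Submodule ℂ (Fin n → ℂ)) = m := by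
  have hli : LinearIndependent ℂ
      (fun j : {j : Fin n // bit m mu j = 1} => (e (j : Fin n) : Fin n → ℂ)) :=
    (Pi.linearIndependent_single_one (Fin n) ℂ).comp _ Subtype.val_injective
  have hspan : (repW m mu : Submodule ℂ (Fin n → ℂ)) = Submodule.span ℂ
      (Set.range fun j : {j : Fin n // bit m mu j = 1} => (e (j : Fin n) : Fin n → ℂ)) := by
    unfold repW
    congr 1
    ext x
    constructor
    · rintro ⟨j, hj, rfl⟩
      exact ⟨⟨j, hj⟩, rfl⟩
    · rintro ⟨⟨j, hj⟩, rfl⟩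
      exact ⟨j, hj, rfl⟩
  rw [hspan, finrank_span_eq_card hli, card_bit hm h]

theorem bit_apply_of_ne {lam mu : YoungDiagram} {w : Equiv.Perm (Fin n)}
    (hw : IsConsistent k m lam mu w) {j : Fin n} (hj : bit k lam j = 1) (hne : w j ≠ j) :
    bit k lam (w j) = 0 := by
  have hww : w (w j) = j := by
    have := congrArg (fun g : Equiv.Perm (Fin n) => g j) hw.mul_self
    simpa using this
  rcases lt_or_gt_of_ne hne with hlt | hlt
  · have := (hw.arc (w j) j hlt hww rfl).1
    unfold bitSum at this
    omega
  · have := (hw.arc j (w j) hlt rfl hww).1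
    unfold bitSum at this
    omega

theorem finrank_repU (hk : k ≤ n) {lam mu : YoungDiagram} (h : FitsIn lam k (n - k))
    {w : Equiv.Perm (Fin n)} (hw : IsConsistent k m lam mu w) :
    Module.finrank ℂ (repU k lam w) = k := by
  let f : {j : Fin n // bit k lam j = 1} → (Fin n → ℂ) := fun j =>
    if w j = j then e (j : Fin n) else e (w j) + e (j : Fin n)
  have hcoord : ∀ i j : {j : Fin n // bit k lam j = 1},
      f j i = if i = j then 1 else 0 := by
    rintro ⟨i, hi⟩ ⟨j, hj⟩
    simp only [f]
    split_ifs with h1 h2 h2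
    · simp only [Subtype.mk.injEq] at h2
      simp [e, h2]
    · simp only [Subtype.mk.injEq] at h2
      simp [e, h2]
    · simp only [Subtype.mk.injEq] at h2
      subst h2
      simp [e, Ne.symm h1]
    · simp only [Subtype.mk.injEq] at h2
      have h3 : i ≠ w j := by
        rintro rfl
        have := bit_apply_of_ne hw hj h1
        omega
      simp [e, h2, h3]
  have hli : LinearIndependent ℂ f := by
    rw [Fintype.linearIndependent_iff]
    intro g hg i
    have := congrFun hg (i : Fin n)
    simpa [Finset.sum_apply, hcoord] using this
  have hspan : repU k lam w = Submodule.span ℂ (Set.range f) := by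
    unfold repU
    rw [← Submodule.span_union]
    congr 1
    ext x
    constructor
    · rintro (⟨j, hj, hwj, rfl⟩ | ⟨j, hj, hwj, rfl⟩)
      · exact ⟨⟨j, hj⟩, by simp [f, hwj]⟩
      · exact ⟨⟨j, hj⟩, by simp [f, hwj]⟩
    · rintro ⟨⟨j, hj⟩, rfl⟩
      by_cases hwj : w j = j
      · exact Or.inl ⟨j, hj, hwj, by simp [f, hwj]⟩
      · exact Or.inr ⟨j, hj, hwj, by simp [f, hwj]⟩
  rw [hspan, finrank_span_eq_card hli, card_bit hk h]

/-- The canonical pair of subspaces attached to `w` in `I_n(λ,μ)`. -/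
def canonicalPair (hk : k ≤ n) (hm : m ≤ n) {lam mu : YoungDiagram}
    (hlam : FitsIn lam k (n - k)) (hmu : FitsIn mu m (n - m))
    {w : Equiv.Perm (Fin n)} (hw : IsConsistent k m lam mu w) : DoubleGr n k m where
  U := repU k lam w
  W := repW m mu
  finrank_U := finrank_repU hk hlam hw
  finrank_W := finrank_repW hm hmu

/-- The orbit `O^w_{λμ}` of the Borel subgroup in `Gr(k,n) × Gr(m,n)`. -/
def orbit (hk : k ≤ n) (hm : m ≤ n) {lam mu : YoungDiagram}
    (hlam : FitsIn lam k (n - k)) (hmu : FitsIn mu m (n - m))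
    {w : Equiv.Perm (Fin n)} (hw : IsConsistent k m lam mu w) : Set (DoubleGr n k m) :=
  borelOrbit (canonicalPair hk hm hlam hmu hw)

end DoubleGrassmannian

end

noncomputable section
namespace DoubleGrassmannian
open Matrix Filter Topology
variable {n k m : ℕ}

/-! Call a node of type 0, 1 or 2 according to `bitSum`. Let `N_w` (`arcMatrix w`) be the nilpotent
matrix sending the right end of each arc to its left end. Then `U = (1 + N_w) E` with `E` the
coordinate subspace of `λ` (`repU_eq_map`), while `W` is a coordinate subspace independent of `w`.
An invertible upper triangular `b` that mixes only nodes with equal bits fixes both coordinate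
subspaces, so it acts on these pairs by conjugating `N_w`.

Necessity. The pairs `(u, x)` in `U × W` with `u, x ∈ ⟨e_1, …, e_j⟩` and `u + x ∈ ⟨e_1, …, e_{i-1}⟩`
form a space whose dimension is constant on Borel orbits and can only jump up in a limit. On the
canonical pair it is a number independent of `w` plus the number of type 2 nodes of `[i, j]` that do
not end an arc inside `[i, j]`, hence a constant minus `r_ij(w)` (`intervalCorank_canonicalPair`).
So `r_ij` cannot grow on passing to the closure.

Sufficiency. Four moves on arcs are realised by curves `N_v + t E_ij`, conjugate to `N_w` for `t ≠
0`: deleting an arc, moving a right end to the right, moving a left end to the left, and making two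
nested arcs cross. If `v ≠ w` and `r(v) ≤ r(w)`, some move leads from `w` to `u` with still `r(v) ≤
r(u)` (`exists_degeneration`); it is found at the last left end where `v` and `w` differ. Arc counts
decrease, so the process stops at `v`. -/

/-! ### Limits of curves in the Zariski topology -/

theorem isOpen_aeval_ne_zero (f : MvPolynomial ((Fin n × Fin k) ⊕ (Fin n × Fin m)) ℂ) :
    IsOpen {F : FramePair n k m | MvPolynomial.aeval F.coords f ≠ 0} := by
  refine ⟨PrimeSpectrum.basicOpen f, (PrimeSpectrum.basicOpen f).isOpen, ?_⟩
  ext F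
  simp [MvPolynomial.pointToPoint]

/-- The Zariski topology is coarser than the usual one. -/
theorem tendsto_of_tendsto_coords {c : ℂ → FramePair n k m} {l : Filter ℂ} {F : FramePair n k m}
    (hc : Tendsto (fun t => (c t).coords) l (𝓝 F.coords)) : Tendsto c l (𝓝 F) := by
  rw [nhds_induced, tendsto_comap_iff,
    PrimeSpectrum.isTopologicalBasis_basic_opens.nhds_hasBasis.tendsto_right_iff]
  rintro _ ⟨⟨f, rfl⟩, hf⟩
  have hf' : MvPolynomial.aeval F.coords f ≠ 0 := by
    simpa [PrimeSpectrum.mem_basicOpen, MvPolynomial.pointToPoint] using hf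
  have hcont : Continuous fun x : (Fin n × Fin k) ⊕ (Fin n × Fin m) → ℂ =>
      MvPolynomial.aeval x f := by
    simpa [MvPolynomial.aeval_eq_eval] using MvPolynomial.continuous_eval f
  have := (hcont.tendsto F.coords).comp hc
  filter_upwards [this.eventually_ne hf'] with t ht
  simpa [PrimeSpectrum.mem_basicOpen, MvPolynomial.pointToPoint] using ht

theorem toDoubleGr_mem_closure {c : ℂ → FramePair n k m} {S : Set (DoubleGr n k m)}
    (hc : ContinuousAt (fun t => (c t).coords) 0) (hS : ∀ t ≠ 0, (c t).toDoubleGr ∈ S) :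
    (c 0).toDoubleGr ∈ closure S := by
  have h : Tendsto c (𝓝[≠] 0) (𝓝 (c 0)) :=
    tendsto_of_tendsto_coords (hc.tendsto.mono_left nhdsWithin_le_nhds)
  have hq : Continuous (FramePair.toDoubleGr : FramePair n k m → DoubleGr n k m) :=
    continuous_coinduced_rng
  refine mem_closure_of_tendsto ((hq.tendsto _).comp h) ?_
  filter_upwards [self_mem_nhdsWithin] with t ht using hS t ht

/-! ### Semicontinuity of rank on `U × W` -/

/-- The vectors with coefficient vectors `y` in the frames with given coordinates. -/
def frameCombination (y : (Fin k → ℂ) × (Fin m → ℂ)) :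
    ((Fin n × Fin k) ⊕ (Fin n × Fin m) → ℂ) →ₗ[ℂ] (Fin n → ℂ) × (Fin n → ℂ) where
  toFun c := (fun x => ∑ a, c (Sum.inl (x, a)) * y.1 a, fun x => ∑ a, c (Sum.inr (x, a)) * y.2 a)
  map_add' c d := by ext x <;> simp [add_mul, Finset.sum_add_distrib]
  map_smul' r c := by ext x <;> simp [mul_assoc, Finset.mul_sum]

theorem frameCombination_coords (F : FramePair n k m) (y : (Fin k → ℂ) × (Fin m → ℂ)) :
    frameCombination y F.coords = (F.A *ᵥ y.1, F.C *ᵥ y.2) := rfl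

theorem FramePair.mem_prod_iff (F : FramePair n k m) (x : (Fin n → ℂ) × (Fin n → ℂ)) :
    x ∈ F.toDoubleGr.U.prod F.toDoubleGr.W ↔ ∃ y, frameCombination y F.coords = x := by
  simp only [FramePair.toDoubleGr, ← Matrix.range_mulVecLin, Submodule.mem_prod,
    LinearMap.mem_range, frameCombination_coords, Matrix.mulVecLin_apply, Prod.exists]
  constructor
  · rintro ⟨⟨a, ha⟩, b, hb⟩
    exact ⟨a, b, by simp [ha, hb]⟩
  · rintro ⟨a, b, rfl⟩
    exact ⟨⟨a, rfl⟩, b, rfl⟩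

/-- The polynomial of a linear functional. -/
def linearPolynomial {σ : Type*} [Fintype σ] [DecidableEq σ] (l : (σ → ℂ) →ₗ[ℂ] ℂ) :
    MvPolynomial σ ℂ :=
  ∑ s, MvPolynomial.C (l (Pi.single s 1)) * MvPolynomial.X s

theorem aeval_linearPolynomial {σ : Type*} [Fintype σ] [DecidableEq σ] (l : (σ → ℂ) →ₗ[ℂ] ℂ)
    (c : σ → ℂ) : MvPolynomial.aeval c (linearPolynomial l) = l c := by
  conv_rhs => rw [pi_eq_sum_univ' c, map_sum]
  simp [linearPolynomial, mul_comm, Pi.single]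

/-- Lower semicontinuity of the rank of a linear map on `U × W`. -/
theorem isClosed_finrank_map_le {E : Type*} [AddCommGroup E] [Module ℂ E]
    [FiniteDimensional ℂ E]
    (L : (Fin n → ℂ) × (Fin n → ℂ) →ₗ[ℂ] E) (r : ℕ) :
    IsClosed {P : DoubleGr n k m | Module.finrank ℂ ((P.U.prod P.W).map L) ≤ r} := by
  rw [← isOpen_compl_iff, isOpen_coinduced, isOpen_iff_forall_mem_open]
  intro F hF
  simp only [Set.mem_preimage, Set.mem_compl_iff, Set.mem_ofPred_eq, not_le] at hF
  obtain ⟨g, hg⟩ := exists_linearIndependent_of_le_finrank (Nat.succ_le_of_lt hF)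
  have hy : ∀ a, ∃ y, L (frameCombination y F.coords) = g a := by
    intro a
    obtain ⟨x, hx, hxa⟩ := (g a).2
    obtain ⟨y, rfl⟩ := (F.mem_prod_iff x).1 hx
    exact ⟨y, hxa⟩
  choose y hy using hy
  have hgi : LinearIndependent ℂ (fun a => (g a : E)) :=
    hg.map' (Submodule.subtype _) (Submodule.ker_subtype _)
  -- `X` reads off coordinates with respect to the `r + 1` independent images at `F`. The
  -- determinant `p` of these coordinates, with the coefficient vectors `y` kept fixed while the
  -- frame varies, is a polynomial equal to 1 at `F`; wherever it is nonzero the rank is at least `r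
  -- + 1`.
  obtain ⟨X, hX⟩ := (Fintype.linearCombination ℂ (fun a => (g a : E))).exists_leftInverse_of_injective
    (LinearMap.ker_eq_bot.2 hgi.fintypeLinearCombination_injective)
  let ℓ : Fin (r + 1) → Fin (r + 1) → ((Fin n × Fin k) ⊕ (Fin n × Fin m) → ℂ) →ₗ[ℂ] ℂ :=
    fun a b => LinearMap.proj a ∘ₗ X ∘ₗ L ∘ₗ frameCombination (y b)
  let p : MvPolynomial ((Fin n × Fin k) ⊕ (Fin n × Fin m)) ℂ :=
    (Matrix.of fun a b => linearPolynomial (ℓ a b)).det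
  have hp : ∀ c, MvPolynomial.aeval c p = (Matrix.of fun a b => ℓ a b c).det := by
    intro c
    simp only [p]
    rw [AlgHom.map_det]
    congr 1
    ext a b
    simpa using aeval_linearPolynomial (ℓ a b) c
  refine ⟨_, ?_, isOpen_aeval_ne_zero p, ?_⟩
  · intro G hG
    simp only [Set.mem_preimage, Set.mem_compl_iff, Set.mem_ofPred_eq, not_le]
    have hG' : (Matrix.of fun a b => ℓ a b G.coords).det ≠ 0 := by rw [← hp]; exact hG
    have hli : LinearIndependent ℂ (Matrix.of fun a b => ℓ a b G.coords).col :=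
      Matrix.linearIndependent_cols_of_det_ne_zero hG'
    let h : Fin (r + 1) → ((G.toDoubleGr.U.prod G.toDoubleGr.W).map L) := fun b =>
      ⟨L (frameCombination (y b) G.coords), Submodule.mem_map_of_mem
        ((G.mem_prod_iff _).2 ⟨_, rfl⟩)⟩
    have hh : LinearIndependent ℂ h := by
      apply LinearIndependent.of_comp (X ∘ₗ Submodule.subtype _)
      exact hli
    simpa using hh.fintype_card_le_finrank
  · show MvPolynomial.aeval F.coords p ≠ 0
    rw [hp]
    have : (Matrix.of fun a b => ℓ a b F.coords) = 1 := by
      ext a b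
      have := congrFun (LinearMap.congr_fun hX (Pi.single b 1)) a
      simp only [LinearMap.comp_apply, Fintype.linearCombination_apply_single, one_smul] at this
      simp [ℓ, hy, this, Matrix.one_apply, Pi.single_apply]
    simp [this]

/-! ### Canonical pairs as graphs of arc matrices, and their degenerations -/

theorem mem_repW_iff {mu : YoungDiagram} {x : Fin n → ℂ} :
    x ∈ repW m mu ↔ ∀ p, bit m mu p ≠ 1 → x p = 0 := by
  constructor
  · intro hx p hp
    unfold repW at hx
    induction hx using Submodule.span_induction with
    | mem x h =>
      obtain ⟨j, hj, rfl⟩ := h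
      have : p ≠ j := by rintro rfl; exact hp hj
      simp [e, this]
    | zero => rfl
    | add x y _ _ hx hy => simp [hx, hy]
    | smul c x _ hx => simp [hx]
  · intro h
    rw [pi_eq_sum_univ' x]
    refine Submodule.sum_mem _ fun p _ => ?_
    by_cases hp : bit m mu p = 1
    · refine Submodule.smul_mem _ _ (Submodule.subset_span ⟨p, hp, ?_⟩)
      ext q
      simp [e, Pi.single_apply, eq_comm]
    · simp [h p hp]

/-- The matrix of the partial map sending the larger end of each arc to the smaller one. -/
def arcMatrix (w : Equiv.Perm (Fin n)) : Matrix (Fin n) (Fin n) ℂ :=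
  Matrix.of fun q p => if w p = q ∧ q < p then 1 else 0

theorem arcMatrix_mulVec_e (w : Equiv.Perm (Fin n)) (p : Fin n) :
    arcMatrix w *ᵥ e p = if w p < p then e (w p) else 0 := by
  ext q
  simp only [e, mulVec_single_one, col_apply, arcMatrix, of_apply]
  by_cases h : w p = q
  · subst h
    by_cases h' : w p < p <;> simp [h']
  · have h2 : q ≠ w p := fun hq => h hq.symm
    by_cases h' : w p < p <;> simp [h, h', h2]

theorem IsConsistent.apply_apply {lam mu : YoungDiagram} {w : Equiv.Perm (Fin n)}
    (hw : IsConsistent k m lam mu w) (p : Fin n) : w (w p) = p := by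
  simpa using congrArg (fun g : Equiv.Perm (Fin n) => g p) hw.mul_self

theorem IsConsistent.bitSum_of_lt {lam mu : YoungDiagram} {w : Equiv.Perm (Fin n)}
    (hw : IsConsistent k m lam mu w) {p : Fin n} (hp : p < w p) :
    bitSum k m lam mu p = 0 ∧ bitSum k m lam mu (w p) = 2 :=
  hw.arc p (w p) hp rfl (hw.apply_apply p)

theorem IsConsistent.bitSum_of_gt {lam mu : YoungDiagram} {w : Equiv.Perm (Fin n)}
    (hw : IsConsistent k m lam mu w) {p : Fin n} (hp : w p < p) :
    bitSum k m lam mu (w p) = 0 ∧ bitSum k m lam mu p = 2 :=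
  hw.arc (w p) p hp (hw.apply_apply p) rfl

theorem bit_le_one (lam : YoungDiagram) (p : Fin n) : bit k lam p ≤ 1 := by
  unfold bit; split_ifs <;> simp

theorem bit_eq_of_bitSum_eq {lam mu : YoungDiagram} {p q : Fin n}
    (hp : bitSum k m lam mu p = bitSum k m lam mu q) (hpq : bitSum k m lam mu p ≠ 1) :
    bit k lam p = bit k lam q ∧ bit m mu p = bit m mu q := by
  have := bit_le_one (k := k) lam p
  have := bit_le_one (k := k) lam q
  have := bit_le_one (k := m) mu p
  have := bit_le_one (k := m) mu q
  unfold bitSum at *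
  omega

/-- A node with `s_j(λ) = 1` cannot be a left end, since left ends have type 0. So on `E` the matrix
`1 + N_w` adds exactly the partner of each right end. -/
theorem repU_eq_map {lam mu : YoungDiagram} {w : Equiv.Perm (Fin n)}
    (hw : IsConsistent k m lam mu w) :
    repU k lam w = (repW k lam).map (toLin' (1 + arcMatrix w)) := by
  have key : ∀ j, bit k lam j = 1 →
      (1 + arcMatrix w) *ᵥ e j = if w j = j then e j else e (w j) + e j := by
    intro j hj
    rw [add_mulVec, one_mulVec, arcMatrix_mulVec_e]
    rcases lt_trichotomy (w j) j with h | h | h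
    · rw [if_pos h, if_neg h.ne, add_comm]
    · simp [h]
    · have := (hw.bitSum_of_lt h).1
      unfold bitSum at this
      omega
  unfold repU repW
  rw [Submodule.map_span, ← Submodule.span_union]
  congr 1
  ext x
  constructor
  · rintro (⟨j, hj, hwj, rfl⟩ | ⟨j, hj, hwj, rfl⟩)
    · exact ⟨e j, ⟨j, hj, rfl⟩, by rw [toLin'_apply, key j hj, if_pos hwj]⟩
    · exact ⟨e j, ⟨j, hj, rfl⟩, by rw [toLin'_apply, key j hj, if_neg hwj]⟩
  · rintro ⟨_, ⟨j, hj, rfl⟩, rfl⟩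
    rw [toLin'_apply, key j hj]
    by_cases hwj : w j = j
    · exact Or.inl ⟨j, hj, hwj, by rw [if_pos hwj]⟩
    · exact Or.inr ⟨j, hj, hwj, by rw [if_neg hwj]⟩

/-- Columns of the identity matrix. -/
def selectionMatrix {r : ℕ} (f : Fin r → Fin n) : Matrix (Fin n) (Fin r) ℂ :=
  (1 : Matrix (Fin n) (Fin n) ℂ).submatrix id f

theorem range_selectionMatrix {mu : YoungDiagram} (ε : Fin m ≃ {j : Fin n // bit m mu j = 1}) :
    LinearMap.range (selectionMatrix (fun a => (ε a : Fin n))).mulVecLin = repW m mu := by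
  rw [range_mulVecLin]
  unfold repW
  congr 1
  have hcol : ∀ a, (selectionMatrix (fun a => (ε a : Fin n))).col a = e (ε a : Fin n) := by
    intro a
    ext x
    simp [selectionMatrix, e, one_apply, Pi.single_apply]
  ext x
  constructor
  · rintro ⟨a, rfl⟩
    exact ⟨ε a, (ε a).2, hcol a⟩
  · rintro ⟨j, hj, rfl⟩
    exact ⟨ε.symm ⟨j, hj⟩, by rw [hcol]; simp⟩

theorem linearIndependent_col_of_mul_eq_one {r : ℕ} {A : Matrix (Fin n) (Fin r) ℂ}
    {B : Matrix (Fin r) (Fin n) ℂ} (h : B * A = 1) : LinearIndependent ℂ A.col := by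
  rw [← mulVec_injective_iff]
  intro x y hxy
  have := congrArg (B *ᵥ ·) hxy
  simpa [mulVec_mulVec, h] using this

theorem selectionMatrix_transpose_mul_mul {r : ℕ} (f : Fin r → Fin n)
    (X : Matrix (Fin n) (Fin n) ℂ) :
    (selectionMatrix f)ᵀ * X * selectionMatrix f = X.submatrix f f := by
  ext a b
  simp [selectionMatrix, mul_apply, one_apply]

/-- A pair of graphs of matrices is a limit of the pairs for nearby matrices. -/
theorem mem_closure_of_graph (hk : k ≤ n) (hm : m ≤ n) {lam mu : YoungDiagram}
    (hlam : FitsIn lam k (n - k)) (hmu : FitsIn mu m (n - m))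
    (g : GL (Fin n) ℂ) (N : ℂ → Matrix (Fin n) (Fin n) ℂ) (hN : ContinuousAt N 0)
    (hz : ∀ t p q, bit k lam p = 1 → bit k lam q = 1 → N t q p = 0) {S : Set (DoubleGr n k m)}
    (hS : ∀ t ≠ 0, ∀ P : DoubleGr n k m,
      P.U = (repW k lam).map (toLin' (g.1 * (1 + N t))) → P.W = (repW m mu).map (toLin' g.1) →
      P ∈ S)
    (P : DoubleGr n k m) (hU : P.U = (repW k lam).map (toLin' (g.1 * (1 + N 0))))
    (hW : P.W = (repW m mu).map (toLin' g.1)) : P ∈ closure S := by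
  have ε : Fin k ≃ {j : Fin n // bit k lam j = 1} :=
    (Fintype.equivFinOfCardEq (card_bit hk hlam)).symm
  have δ : Fin m ≃ {j : Fin n // bit m mu j = 1} :=
    (Fintype.equivFinOfCardEq (card_bit hm hmu)).symm
  have hinv : g⁻¹.1 * g.1 = 1 := by simp
  let c : ℂ → FramePair n k m := fun t =>
    { A := g.1 * (1 + N t) * selectionMatrix (fun a => (ε a : Fin n))
      C := g.1 * selectionMatrix (fun a => (δ a : Fin n))
      -- By `hz` the rows and columns of `1 + N t` indexed by `λ` form an identity matrix, which
      -- gives a left inverse for every `t`, including `t = 0`.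
      linInd_A := by
        apply linearIndependent_col_of_mul_eq_one
          (B := (selectionMatrix (fun a => (ε a : Fin n)))ᵀ * g⁻¹.1)
        have : (selectionMatrix fun a => (ε a : Fin n))ᵀ * g⁻¹.1 *
            (g.1 * (1 + N t) * selectionMatrix fun a => (ε a : Fin n)) =
            (selectionMatrix fun a => (ε a : Fin n))ᵀ * ((g⁻¹.1 * g.1) * (1 + N t)) *
              selectionMatrix fun a => (ε a : Fin n) := by
          simp only [Matrix.mul_assoc]
        rw [this, hinv, Matrix.one_mul, selectionMatrix_transpose_mul_mul]
        ext a b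
        simp [one_apply, hz t _ _ (ε b).2 (ε a).2, Subtype.val_injective.eq_iff]
      linInd_C := by
        apply linearIndependent_col_of_mul_eq_one
          (B := (selectionMatrix (fun a => (δ a : Fin n)))ᵀ * g⁻¹.1)
        have : (selectionMatrix fun a => (δ a : Fin n))ᵀ * g⁻¹.1 *
            (g.1 * selectionMatrix fun a => (δ a : Fin n)) =
            (selectionMatrix fun a => (δ a : Fin n))ᵀ * (g⁻¹.1 * g.1) *
              selectionMatrix fun a => (δ a : Fin n) := by
          simp only [Matrix.mul_assoc]
        rw [this, hinv, selectionMatrix_transpose_mul_mul]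
        ext a b
        simp [one_apply, Subtype.val_injective.eq_iff] }
  have hcU : ∀ t, (c t).toDoubleGr.U = (repW k lam).map (toLin' (g.1 * (1 + N t))) := by
    intro t
    simp only [FramePair.toDoubleGr, c]
    rw [← range_mulVecLin, mulVecLin_mul, LinearMap.range_comp, range_selectionMatrix]
    rfl
  have hcW : ∀ t, (c t).toDoubleGr.W = (repW m mu).map (toLin' g.1) := by
    intro t
    simp only [FramePair.toDoubleGr, c]
    rw [← range_mulVecLin, mulVecLin_mul, LinearMap.range_comp, range_selectionMatrix]
    rfl
  have hP : P = (c 0).toDoubleGr := DoubleGr.ext (hU.trans (hcU 0).symm) (hW.trans (hcW 0).symm)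
  rw [hP]
  refine toDoubleGr_mem_closure ?_ fun t ht => hS t ht _ (hcU t) (hcW t)
  rw [continuousAt_pi]
  have hA : ContinuousAt (fun t => (c t).A) 0 := by
    simp only [c]
    fun_prop
  rintro (⟨x, a⟩ | ⟨x, a⟩)
  · exact (continuousAt_pi.1 (continuousAt_pi.1 hA x) a)
  · exact continuousAt_const

theorem map_repW_of_preserves {mu : YoungDiagram} {b : Matrix (Fin n) (Fin n) ℂ}
    (hb : IsUnit b.det) (h : ∀ p q, b q p ≠ 0 → bit m mu p = bit m mu q) :
    (repW m mu).map (toLin' b) = repW m mu := by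
  apply Submodule.eq_of_le_of_finrank_eq
  · rintro _ ⟨x, hx, rfl⟩
    rw [SetLike.mem_coe, mem_repW_iff] at hx
    rw [mem_repW_iff]
    intro q hq
    simp only [toLin'_apply, mulVec, dotProduct]
    refine Finset.sum_eq_zero fun p _ => ?_
    by_cases hbp : b q p = 0
    · simp [hbp]
    · rw [hx p (by rw [h p q hbp]; exact hq), mul_zero]
  · refine (Submodule.equivMapOfInjective (toLin' b) ?_ _).finrank_eq.symm
    exact mulVec_injective_of_isUnit ((isUnit_iff_isUnit_det b).2 hb)

/-- From `b N_w = N(t) b` follows `b (1 + N_w) = (1 + N(t)) b`. As `b` fixes both coordinate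
subspaces, the pair defined by `N(t)` is `b` times the canonical pair of `w`. Its limit at `t = 0`
is the canonical pair of `v`; translating the curve by `g` reaches every other point of the orbit.
-/
theorem orbit_subset_closure_of_degeneration (hk : k ≤ n) (hm : m ≤ n) {lam mu : YoungDiagram}
    (hlam : FitsIn lam k (n - k)) (hmu : FitsIn mu m (n - m)) {v w : Equiv.Perm (Fin n)}
    (hv : IsConsistent k m lam mu v) (hw : IsConsistent k m lam mu w)
    (N : ℂ → Matrix (Fin n) (Fin n) ℂ) (hN : ContinuousAt N 0) (hN0 : N 0 = arcMatrix v)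
    (hz : ∀ t p q, bit k lam p = 1 → bit k lam q = 1 → N t q p = 0)
    (h : ∀ t ≠ 0, ∃ b : Matrix (Fin n) (Fin n) ℂ, b.BlockTriangular id ∧ (∀ p, b p p ≠ 0) ∧
      (∀ p q, b q p ≠ 0 → bit k lam p = bit k lam q ∧ bit m mu p = bit m mu q) ∧
      b * arcMatrix w = N t * b) :
    orbit hk hm hlam hmu hv ⊆ closure (orbit hk hm hlam hmu hw) := by
  rintro P ⟨g, hg, hU, hW⟩
  refine mem_closure_of_graph hk hm hlam hmu g N hN hz ?_ P ?_ hW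
  · intro t ht Q hQU hQW
    obtain ⟨b, hb, hd, hbit, hbN⟩ := h t ht
    have hdet : IsUnit b.det := by
      rw [det_of_isUpperTriangular hb, isUnit_iff_ne_zero]
      exact Finset.prod_ne_zero_iff.2 fun p _ => hd p
    let b' : GL (Fin n) ℂ := Matrix.GeneralLinearGroup.mk'' b hdet
    have hb' : b' ∈ borel n := hb
    refine ⟨g * b', mul_mem hg hb', ?_, ?_⟩
    · change Q.U = (repU k lam w).map (toLin' (g.1 * b))
      rw [repU_eq_map hw, ← Submodule.map_comp, ← toLin'_mul, hQU]
      have : g.1 * b * (1 + arcMatrix w) = g.1 * (1 + N t) * b := by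
        rw [Matrix.mul_assoc, Matrix.mul_add, hbN, Matrix.mul_assoc, Matrix.add_mul]
        simp
      rw [this, toLin'_mul _ b, Submodule.map_comp,
        map_repW_of_preserves hdet fun p q hpq => (hbit p q hpq).1]
    · change Q.W = (repW m mu).map (toLin' (g.1 * b))
      rw [toLin'_mul _ b, Submodule.map_comp,
        map_repW_of_preserves hdet fun p q hpq => (hbit p q hpq).2, hQW]
  · rw [hN0, toLin'_mul, Submodule.map_comp, ← repU_eq_map hv]
    exact hU

/-! ### The four elementary degenerations -/

theorem matrix_ext_mulVec_e {A B : Matrix (Fin n) (Fin n) ℂ} (h : ∀ p, A *ᵥ e p = B *ᵥ e p) :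
    A = B := by
  ext q p
  simpa [e] using congrFun (h p) q

theorem diagonal_mulVec_e (d : Fin n → ℂ) (p : Fin n) : diagonal d *ᵥ e p = d p • e p := by
  ext q
  by_cases h : q = p <;> simp [e, h, diagonal]

theorem single_mulVec_e (i j : Fin n) (c : ℂ) (p : Fin n) :
    single i j c *ᵥ e p = if p = j then c • e i else 0 := by
  ext q
  by_cases h : p = j
  · subst h
    by_cases h' : q = i <;> simp [e, h', single, @eq_comm _ i]
  · simp [e, h, single, Ne.symm h]

theorem blockTriangular_single {i j : Fin n} (h : i < j) (c : ℂ) :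
    (single i j c).BlockTriangular id := by
  intro p q hqp
  simp only [id] at hqp
  rw [single_apply_of_ne]
  rintro ⟨rfl, rfl⟩
  exact absurd h (not_lt.2 hqp.le)

/-- The case `N(t) = N_v + t E_ij`, for which a diagonal matrix plus two elementary terms suffices
as `b`. The two nodes of an elementary term must share both bits; equal type ensures this except for
type 1, where the bits may be interchanged. -/
theorem orbit_subset_closure_of_diagonal_add_singles (hk : k ≤ n) (hm : m ≤ n)
    {lam mu : YoungDiagram} (hlam : FitsIn lam k (n - k)) (hmu : FitsIn mu m (n - m))
    {v w : Equiv.Perm (Fin n)}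
    (hv : IsConsistent k m lam mu v) (hw : IsConsistent k m lam mu w) {i j : Fin n}
    (hij : i < j) (hwij : w i = j)
    (h : ∀ t : ℂ, t ≠ 0 → ∃ (d : Fin n → ℂ) (p₁ q₁ p₂ q₂ : Fin n) (c₁ c₂ : ℂ),
      (∀ p, d p ≠ 0) ∧
      (c₁ = 0 ∨ p₁ < q₁ ∧ bitSum k m lam mu p₁ = bitSum k m lam mu q₁ ∧
        bitSum k m lam mu p₁ ≠ 1) ∧
      (c₂ = 0 ∨ p₂ < q₂ ∧ bitSum k m lam mu p₂ = bitSum k m lam mu q₂ ∧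
        bitSum k m lam mu p₂ ≠ 1) ∧
      (diagonal d + single p₁ q₁ c₁ + single p₂ q₂ c₂) * arcMatrix w =
        (arcMatrix v + single i j t) * (diagonal d + single p₁ q₁ c₁ + single p₂ q₂ c₂)) :
    orbit hk hm hlam hmu hv ⊆ closure (orbit hk hm hlam hmu hw) := by
  have hi0 : bit k lam i = 0 := by
    have := (hw.bitSum_of_lt (hwij ▸ hij)).1
    unfold bitSum at this
    omega
  refine orbit_subset_closure_of_degeneration hk hm hlam hmu hv hw
    (fun t => arcMatrix v + single i j t) ?_ (by simp) ?_ ?_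
  · refine continuousAt_const.add ?_
    have hs : (single i j : ℂ → Matrix (Fin n) (Fin n) ℂ) = fun t => t • single i j 1 := by
      ext t : 1
      simp
    change ContinuousAt (single i j) 0
    rw [hs]
    exact continuousAt_id.smul continuousAt_const
  · intro t p q hp hq
    have h1 : arcMatrix v q p = 0 := by
      simp only [arcMatrix, of_apply, ite_eq_right_iff, one_ne_zero, imp_false, not_and]
      rintro rfl hlt
      have := (hv.bitSum_of_gt hlt).1
      unfold bitSum at this
      omega
    have h2 : single i j t q p = 0 := by
      apply single_apply_of_ne
      rintro ⟨rfl, rfl⟩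
      omega
    simp [h1, h2]
  · intro t ht
    obtain ⟨d, p₁, q₁, p₂, q₂, c₁, c₂, hd, h₁, h₂, hmul⟩ := h t ht
    have hs : ∀ {p q : Fin n} {c : ℂ}, (c = 0 ∨ p < q ∧ bitSum k m lam mu p =
        bitSum k m lam mu q ∧ bitSum k m lam mu p ≠ 1) →
        (single p q c).BlockTriangular id ∧ (∀ x, single p q c x x = 0) ∧
        ∀ x y, single p q c y x ≠ 0 → bit k lam x = bit k lam y ∧ bit m mu x = bit m mu y := by
      rintro p q c (rfl | ⟨hlt, hb, hb1⟩)
      · simp [BlockTriangular]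
      · refine ⟨blockTriangular_single hlt c, fun x => ?_, fun x y hxy => ?_⟩
        · apply single_apply_of_ne
          rintro ⟨rfl, rfl⟩
          exact lt_irrefl _ hlt
        · have : p = y ∧ q = x := by
            by_contra hc
            exact hxy (single_apply_of_ne p q c y x hc)
          obtain ⟨rfl, rfl⟩ := this
          have := bit_eq_of_bitSum_eq hb hb1
          exact ⟨this.1.symm, this.2.symm⟩
    obtain ⟨t₁, z₁, b₁⟩ := hs h₁
    obtain ⟨t₂, z₂, b₂⟩ := hs h₂
    refine ⟨_, ((blockTriangular_diagonal d).add t₁).add t₂, ?_, ?_, hmul⟩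
    · intro p
      simp [z₁, z₂, hd]
    · intro p q hpq
      by_cases hqp : q = p
      · simp [hqp]
      · by_cases h1 : single p₁ q₁ c₁ q p = 0
        · by_cases h2 : single p₂ q₂ c₂ q p = 0
          · simp [diagonal_apply_ne _ hqp, h1, h2] at hpq
          · exact b₂ p q h2
        · exact b₁ p q h1

section Moves

variable (hk : k ≤ n) (hm : m ≤ n) {lam mu : YoungDiagram}
  (hlam : FitsIn lam k (n - k)) (hmu : FitsIn mu m (n - m)) {v w : Equiv.Perm (Fin n)}
  (hv : IsConsistent k m lam mu v) (hw : IsConsistent k m lam mu w)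

/-- Here `N(t)` is `N_w` with the arc scaled by `t`, which is conjugation by `e_i ↦ t e_i`. -/
theorem orbit_subset_closure_of_remove {i j : Fin n} (hij : i < j) (hwi : w i = j)
    (hvi : v i = i) (hvj : v j = j) (hvw : ∀ p, p ≠ i → p ≠ j → v p = w p) :
    orbit hk hm hlam hmu hv ⊆ closure (orbit hk hm hlam hmu hw) := by
  refine orbit_subset_closure_of_diagonal_add_singles hk hm hlam hmu hv hw hij hwi ?_
  intro t ht
  refine ⟨fun p => if p = i then t else 1, i, j, i, j, 0, 0, ?_, Or.inl rfl, Or.inl rfl, ?_⟩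
  · intro p; dsimp only; split_ifs <;> simp [ht]
  have hwj : w j = i := by rw [← hwi, hw.apply_apply]
  refine matrix_ext_mulVec_e fun p => ?_
  simp only [single_zero, add_zero, ← mulVec_mulVec, arcMatrix_mulVec_e, diagonal_mulVec_e,
    mulVec_smul, add_mulVec, single_mulVec_e]
  by_cases hpj : p = j
  · subst hpj
    simp [hwj, hvj, hij, hij.ne', diagonal_mulVec_e]
  by_cases hpi : p = i
  · subst hpi
    simp [hwi, hvi, hij.not_gt, hpj]
  have hwp : w p ≠ i := fun h => hpj (by rw [← hwi, ← h, hw.apply_apply])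
  rw [hvw p hpi hpj]
  by_cases hlt : w p < p <;> simp [hlt, hpi, hpj, diagonal_mulVec_e, hwp]

/-- `N(t)` sends `e_j` to `t e_i` and `e_{j'}` to `e_i`, so it kills `e_{j'} - t⁻¹ e_j`. This vector
takes the place of the fixed node `j'` of `w`. -/
theorem orbit_subset_closure_of_move_right {i j j' : Fin n} (hij : i < j) (hjj' : j < j')
    (hT : bitSum k m lam mu j' = 2) (hwi : w i = j) (hwj' : w j' = j')
    (hvi : v i = j') (hvj : v j = j) (hvw : ∀ p, p ≠ i → p ≠ j → p ≠ j' → v p = w p) :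
    orbit hk hm hlam hmu hv ⊆ closure (orbit hk hm hlam hmu hw) := by
  refine orbit_subset_closure_of_diagonal_add_singles hk hm hlam hmu hv hw hij hwi ?_
  intro t ht
  have hTj : bitSum k m lam mu j = 2 := hwi ▸ (hw.bitSum_of_lt (hwi ▸ hij)).2
  refine ⟨fun p => if p = i then t else 1, j, j', i, j, - t⁻¹, 0, ?_,
    Or.inr ⟨hjj', by rw [hT, hTj], by simp [hTj]⟩, Or.inl rfl, ?_⟩
  · intro p; dsimp only; split_ifs <;> simp [ht]
  have hwj : w j = i := by rw [← hwi, hw.apply_apply]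
  have hvj' : v j' = i := by rw [← hvi, hv.apply_apply]
  have hij' := hij.trans hjj'
  refine matrix_ext_mulVec_e fun p => ?_
  simp only [single_zero, add_zero, ← mulVec_mulVec, arcMatrix_mulVec_e, diagonal_mulVec_e,
    mulVec_smul, mulVec_add, add_mulVec, single_mulVec_e]
  by_cases hpj : p = j
  · subst hpj
    simp [hwj, hvj, hij, hij.ne', diagonal_mulVec_e, single_mulVec_e, hjj'.ne, hij'.ne]
  by_cases hpi : p = i
  · subst hpi
    simp [hwi, hvi, hij.not_gt, hpj, hij'.not_gt, hij'.ne]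
  by_cases hpj' : p = j'
  · subst hpj'
    simp [hwj', hvj', hvj, hij', hjj'.ne', hij'.ne', single_mulVec_e, arcMatrix_mulVec_e,
      mulVec_neg, mulVec_smul, ht]
  have hwp : w p ≠ i := fun h => hpj (by rw [← hwi, ← h, hw.apply_apply])
  have hwp' : w p ≠ j' := fun h => hpj' (by rw [← hwj', ← h, hw.apply_apply])
  rw [hvw p hpi hpj hpj']
  by_cases hlt : w p < p <;>
    simp [hlt, hpi, hpj, hpj', diagonal_mulVec_e, single_mulVec_e, hwp, hwp']

/-- `N(t)` sends `e_j` to `t e_i + e_{i'}`, which takes the place of `e_i`. -/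
theorem orbit_subset_closure_of_move_up {i i' j : Fin n} (hij : i < j) (hi'i : i' < i)
    (hZ : bitSum k m lam mu i' = 0) (hwi : w i = j) (hwi' : w i' = i')
    (hvi : v i = i) (hvj : v j = i') (hvw : ∀ p, p ≠ i → p ≠ i' → p ≠ j → v p = w p) :
    orbit hk hm hlam hmu hv ⊆ closure (orbit hk hm hlam hmu hw) := by
  refine orbit_subset_closure_of_diagonal_add_singles hk hm hlam hmu hv hw hij hwi ?_
  intro t ht
  have hZi : bitSum k m lam mu i = 0 := (hw.bitSum_of_lt (hwi ▸ hij)).1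
  refine ⟨fun p => if p = i then t else 1, i', i, i, j, 1, 0, ?_,
    Or.inr ⟨hi'i, by rw [hZ, hZi], by simp [hZ]⟩, Or.inl rfl, ?_⟩
  · intro p; dsimp only; split_ifs <;> simp [ht]
  have hwj : w j = i := by rw [← hwi, hw.apply_apply]
  have hvi' : v i' = j := by rw [← hvj, hv.apply_apply]
  have hi'j := hi'i.trans hij
  refine matrix_ext_mulVec_e fun p => ?_
  simp only [single_zero, add_zero, ← mulVec_mulVec, arcMatrix_mulVec_e, diagonal_mulVec_e,
    mulVec_smul, mulVec_add, add_mulVec, single_mulVec_e]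
  by_cases hpj : p = j
  · subst hpj
    simp [hwj, hvj, hij, hij.ne', hi'j, diagonal_mulVec_e, single_mulVec_e, add_comm]
  by_cases hpi : p = i
  · subst hpi
    simp [hwi, hvi, hvi', hij.not_gt, hi'j.not_gt, hpj, hi'j.ne, arcMatrix_mulVec_e,
      single_mulVec_e]
  by_cases hpi' : p = i'
  · subst hpi'
    simp [hwi', hvi', hi'j.not_gt, hi'j.ne, hi'i.ne]
  have hwp : w p ≠ i := fun h => hpj (by rw [← hwi, ← h, hw.apply_apply])
  rw [hvw p hpi hpi' hpj]
  by_cases hlt : w p < p <;>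
    simp [hlt, hpi, hpj, diagonal_mulVec_e, single_mulVec_e, hwp]

/-- The nested arcs of `w` become crossing arcs of `v`. `N(t)` sends `e_j` to `t e_i + e_{i'}` and
`e_{j'}` to `e_i`, hence `e_{j'} - t⁻¹ e_j` to `-t⁻¹ e_{i'}`. These vectors are the images under `b`
of `e_j`, `e_i`, `e_{j'}` and `e_{i'}`. -/
theorem orbit_subset_closure_of_uncross {i i' j j' : Fin n} (hij : i < j) (hi'i : i' < i)
    (hjj' : j < j') (hwi : w i = j) (hwi' : w i' = j')
    (hvi : v i = j') (hvj : v j = i')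
    (hvw : ∀ p, p ≠ i → p ≠ i' → p ≠ j → p ≠ j' → v p = w p) :
    orbit hk hm hlam hmu hv ⊆ closure (orbit hk hm hlam hmu hw) := by
  refine orbit_subset_closure_of_diagonal_add_singles hk hm hlam hmu hv hw hij hwi ?_
  intro t ht
  have hi'j := hi'i.trans hij
  have hij' := hij.trans hjj'
  have hi'j' := hi'i.trans hij'
  have hb := hw.bitSum_of_lt (hwi ▸ hij)
  have hb' := hw.bitSum_of_lt (p := i') (by rwa [hwi'])
  rw [hwi] at hb
  rw [hwi'] at hb'
  refine ⟨fun p => if p = i then t else if p = i' then - t⁻¹ else 1, i', i, j, j', 1, - t⁻¹, ?_,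
    Or.inr ⟨hi'i, by rw [hb.1, hb'.1], by simp [hb']⟩,
    Or.inr ⟨hjj', by rw [hb.2, hb'.2], by simp [hb]⟩, ?_⟩
  · intro p; dsimp only; split_ifs <;> simp [ht]
  have hwj : w j = i := by rw [← hwi, hw.apply_apply]
  have hwj' : w j' = i' := by rw [← hwi', hw.apply_apply]
  have hvi' : v i' = j := by rw [← hvj, hv.apply_apply]
  have hvj' : v j' = i := by rw [← hvi, hv.apply_apply]
  refine matrix_ext_mulVec_e fun p => ?_
  simp only [← mulVec_mulVec, arcMatrix_mulVec_e, diagonal_mulVec_e,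
    mulVec_smul, mulVec_add, add_mulVec, single_mulVec_e]
  by_cases hpj : p = j
  · subst hpj
    simp [hwj, hvj, hij, hij.ne', hi'j, hi'j.ne', diagonal_mulVec_e, single_mulVec_e, hij'.ne,
      hjj'.ne, add_comm]
  by_cases hpi : p = i
  · subst hpi
    simp [hwi, hvi, hvi', hij.not_gt, hi'j.not_gt, hij'.not_gt, hpj, hi'j.ne, hij'.ne,
      arcMatrix_mulVec_e, single_mulVec_e]
  by_cases hpi' : p = i'
  · subst hpi'
    simp [hwi', hvi', hi'j.not_gt, hi'j'.not_gt, hi'j.ne, hi'i.ne, hi'j'.ne]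
  by_cases hpj' : p = j'
  · subst hpj'
    simp [hwj', hvj', hvj, hij', hi'j', hi'j, hpj, hij'.ne', hi'j'.ne', hi'i.ne, hi'j'.ne,
      single_mulVec_e, arcMatrix_mulVec_e, diagonal_mulVec_e, mulVec_neg, mulVec_smul, ht]
  have hwp : w p ≠ i := fun h => hpj (by rw [← hwi, ← h, hw.apply_apply])
  have hwp1 : w p ≠ i' := fun h => hpj' (by rw [← hwi', ← h, hw.apply_apply])
  have hwp2 : w p ≠ j' := fun h => hpi' (by rw [← hwj', ← h, hw.apply_apply])
  rw [hvw p hpi hpi' hpj hpj']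
  by_cases hlt : w p < p <;>
    simp [hlt, hpi, hpj, hpi', hpj', diagonal_mulVec_e, single_mulVec_e, hwp, hwp1, hwp2]

end Moves

/-! ### Arc counts and their change under the four moves -/

/-- The left ends of the arcs inside `[a, c]`. -/
def arcStarts (w : Equiv.Perm (Fin n)) (a c : Fin n) : Finset (Fin n) :=
  Finset.univ.filter fun p => a ≤ p ∧ p < w p ∧ w p ≤ c

theorem mem_arcStarts {w : Equiv.Perm (Fin n)} {a c p : Fin n} :
    p ∈ arcStarts w a c ↔ a ≤ p ∧ p < w p ∧ w p ≤ c := by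
  simp [arcStarts]

theorem card_arcStarts (w : Equiv.Perm (Fin n)) (a c : Fin n) :
    (arcStarts w a c).card = arcCount w a c := by
  unfold arcCount
  refine Finset.card_bij (fun p _ => (p, w p)) ?_ ?_ ?_
  · intro p hp
    simpa [mem_arcStarts] using hp
  · intro p _ q _ h
    exact (Prod.ext_iff.1 h).1
  · rintro ⟨p, q⟩ h
    simp only [Finset.mem_filter, Finset.mem_univ, true_and] at h
    obtain ⟨h1, h2, h3, rfl⟩ := h
    exact ⟨p, mem_arcStarts.2 ⟨h1, h2, h3⟩, rfl⟩

theorem arcCount_eq_sum (w : Equiv.Perm (Fin n)) (a c : Fin n) :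
    arcCount w a c = ∑ p, if a ≤ p ∧ p < w p ∧ w p ≤ c then 1 else 0 := by
  rw [← card_arcStarts, arcStarts, Finset.card_filter]

/-- Each move alters the arcs at no more than two left ends. The additive form avoids subtraction of
natural numbers. -/
theorem arcCount_add_of_eq_off_pair {v w : Equiv.Perm (Fin n)} {i i' : Fin n} (hne : i ≠ i')
    (h : ∀ p, p ≠ i → p ≠ i' → p < v p ∨ p < w p → v p = w p) (a c : Fin n) :
    arcCount v a c + ((if a ≤ i ∧ i < w i ∧ w i ≤ c then 1 else 0) +
        if a ≤ i' ∧ i' < w i' ∧ w i' ≤ c then 1 else 0) =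
      arcCount w a c + ((if a ≤ i ∧ i < v i ∧ v i ≤ c then 1 else 0) +
        if a ≤ i' ∧ i' < v i' ∧ v i' ≤ c then 1 else 0) := by
  have key : ∀ u : Equiv.Perm (Fin n), arcCount u a c =
      (if a ≤ i ∧ i < u i ∧ u i ≤ c then 1 else 0) +
      ((if a ≤ i' ∧ i' < u i' ∧ u i' ≤ c then 1 else 0) +
      ∑ p ∈ (Finset.univ.erase i).erase i', if a ≤ p ∧ p < u p ∧ u p ≤ c then 1 else 0) := by
    intro u
    rw [arcCount_eq_sum, Finset.add_sum_erase _ (fun p => if a ≤ p ∧ p < u p ∧ u p ≤ c then 1 else 0)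
      (by simp [hne.symm]), Finset.add_sum_erase _
      (fun p => if a ≤ p ∧ p < u p ∧ u p ≤ c then 1 else 0) (by simp)]
  have hs : (∑ p ∈ (Finset.univ.erase i).erase i', if a ≤ p ∧ p < v p ∧ v p ≤ c then 1 else 0) =
      ∑ p ∈ (Finset.univ.erase i).erase i', if a ≤ p ∧ p < w p ∧ w p ≤ c then 1 else 0 := by
    refine Finset.sum_congr rfl fun p hp => ?_
    simp only [Finset.mem_erase, Finset.mem_univ, and_true] at hp
    by_cases hpp : p < v p ∨ p < w p
    · rw [h p hp.2 hp.1 hpp]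
    · rw [not_or] at hpp
      simp [hpp]
  rw [key v, key w, hs]
  omega

theorem isConsistent_of_apply {lam mu : YoungDiagram} {w : Equiv.Perm (Fin n)}
    (h : ∀ p, w (w p) = p)
    (h' : ∀ p, p < w p → bitSum k m lam mu p = 0 ∧ bitSum k m lam mu (w p) = 2) :
    IsConsistent k m lam mu w where
  mul_self := by ext p; simp [h]
  arc i j hij hi _ := by subst hi; exact h' i hij

/-- The elementary degenerations `v` of `w`, with the intervals where the arc count drops. -/
structure IsDegeneration (hk : k ≤ n) (hm : m ≤ n) {lam mu : YoungDiagram}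
    (hlam : FitsIn lam k (n - k)) (hmu : FitsIn mu m (n - m)) {w : Equiv.Perm (Fin n)}
    (hw : IsConsistent k m lam mu w) (v : Equiv.Perm (Fin n))
    (D : Fin n → Fin n → Prop) : Prop where
  consistent : IsConsistent k m lam mu v
  subset_closure : orbit hk hm hlam hmu consistent ⊆ closure (orbit hk hm hlam hmu hw)
  arcCount_of_mem : ∀ a c, D a c → arcCount v a c + 1 = arcCount w a c
  arcCount_of_notMem : ∀ a c, ¬ D a c → arcCount v a c = arcCount w a c

section Moves

variable (hk : k ≤ n) (hm : m ≤ n) {lam mu : YoungDiagram}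
  (hlam : FitsIn lam k (n - k)) (hmu : FitsIn mu m (n - m)) {w : Equiv.Perm (Fin n)}
  (hw : IsConsistent k m lam mu w)

theorem exists_degeneration_remove {i j : Fin n} (hij : i < j) (hwi : w i = j) :
    ∃ v, IsDegeneration hk hm hlam hmu hw v fun a c => a ≤ i ∧ j ≤ c := by
  have hww := hw.apply_apply
  have hwj : w j = i := by rw [← hwi, hww]
  have hvi : (w * Equiv.swap i j) i = i := by simp [hwj]
  have hvj : (w * Equiv.swap i j) j = j := by simp [hwi]
  have hvw : ∀ p, p ≠ i → p ≠ j → (w * Equiv.swap i j) p = w p := by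
    intro p h1 h2; simp [Equiv.swap_apply_of_ne_of_ne h1 h2]
  generalize w * Equiv.swap i j = v at hvi hvj hvw
  have hv : IsConsistent k m lam mu v := by
    apply isConsistent_of_apply
    · grind
    · intro p hp
      have := @IsConsistent.bitSum_of_lt n k m lam mu w hw p
      grind
  have hc : ∀ a c, _ := arcCount_add_of_eq_off_pair (v := v) (w := w) hij.ne (by grind)
  refine ⟨v, hv, orbit_subset_closure_of_remove hk hm hlam hmu hv hw hij hwi hvi hvj hvw, ?_, ?_⟩
  all_goals
    intro a c hac
    have := hc a c
    grind

theorem exists_degeneration_move_right {i j j' : Fin n} (hij : i < j) (hjj' : j < j')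
    (hT : bitSum k m lam mu j' = 2) (hwi : w i = j) (hwj' : w j' = j') :
    ∃ v, IsDegeneration hk hm hlam hmu hw v fun a c => a ≤ i ∧ j ≤ c ∧ c < j' := by
  have hww := hw.apply_apply
  have hwj : w j = i := by rw [← hwi, hww]
  -- Conjugating by the transposition of `j` and `j'` relabels the right end of the arc; only the
  -- resulting values are used afterwards.
  have hσ : ∀ p, (Equiv.swap j j' * w * Equiv.swap j j') p =
      Equiv.swap j j' (w (Equiv.swap j j' p)) := fun _ => rfl
  have hvi : (Equiv.swap j j' * w * Equiv.swap j j') i = j' := by grind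
  have hvj : (Equiv.swap j j' * w * Equiv.swap j j') j = j := by grind
  have hvj' : (Equiv.swap j j' * w * Equiv.swap j j') j' = i := by grind
  have hvw : ∀ p, p ≠ i → p ≠ j → p ≠ j' →
      (Equiv.swap j j' * w * Equiv.swap j j') p = w p := by grind
  clear hσ
  generalize Equiv.swap j j' * w * Equiv.swap j j' = v at hvi hvj hvj' hvw
  have hv : IsConsistent k m lam mu v := by
    apply isConsistent_of_apply
    · grind
    · intro p hp
      have := @IsConsistent.bitSum_of_lt n k m lam mu w hw p
      grind
  have hc : ∀ a c, _ := arcCount_add_of_eq_off_pair (v := v) (w := w) hij.ne (by grind)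
  refine ⟨v, hv, orbit_subset_closure_of_move_right hk hm hlam hmu hv hw hij hjj' hT hwi hwj' hvi
    hvj hvw, ?_, ?_⟩
  all_goals
    intro a c hac
    have := hc a c
    grind

theorem exists_degeneration_move_up {i i' j : Fin n} (hij : i < j) (hi'i : i' < i)
    (hZ : bitSum k m lam mu i' = 0) (hwi : w i = j) (hwi' : w i' = i') :
    ∃ v, IsDegeneration hk hm hlam hmu hw v fun a c => i' < a ∧ a ≤ i ∧ j ≤ c := by
  have hww := hw.apply_apply
  have hwj : w j = i := by rw [← hwi, hww]
  have hσ : ∀ p, (Equiv.swap i i' * w * Equiv.swap i i') p =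
      Equiv.swap i i' (w (Equiv.swap i i' p)) := fun _ => rfl
  have hvi : (Equiv.swap i i' * w * Equiv.swap i i') i = i := by grind
  have hvi' : (Equiv.swap i i' * w * Equiv.swap i i') i' = j := by grind
  have hvj : (Equiv.swap i i' * w * Equiv.swap i i') j = i' := by grind
  have hvw : ∀ p, p ≠ i → p ≠ i' → p ≠ j →
      (Equiv.swap i i' * w * Equiv.swap i i') p = w p := by grind
  clear hσ
  generalize Equiv.swap i i' * w * Equiv.swap i i' = v at hvi hvj hvi' hvw
  have hv : IsConsistent k m lam mu v := by
    apply isConsistent_of_apply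
    · grind
    · intro p hp
      have := @IsConsistent.bitSum_of_lt n k m lam mu w hw p
      have := @IsConsistent.bitSum_of_lt n k m lam mu w hw i
      grind
  have hc : ∀ a c, _ := arcCount_add_of_eq_off_pair (v := v) (w := w) hi'i.ne' (by grind)
  refine ⟨v, hv, orbit_subset_closure_of_move_up hk hm hlam hmu hv hw hij hi'i hZ hwi hwi' hvi
    hvj hvw, ?_, ?_⟩
  all_goals
    intro a c hac
    have := hc a c
    grind

theorem exists_degeneration_uncross {i i' j j' : Fin n} (hij : i < j) (hi'i : i' < i)
    (hjj' : j < j') (hwi : w i = j) (hwi' : w i' = j') :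
    ∃ v, IsDegeneration hk hm hlam hmu hw v
      fun a c => i' < a ∧ a ≤ i ∧ j ≤ c ∧ c < j' := by
  have hww := hw.apply_apply
  have hwj : w j = i := by rw [← hwi, hww]
  have hwj' : w j' = i' := by rw [← hwi', hww]
  have hσ : ∀ p, (Equiv.swap i i' * w * Equiv.swap i i') p =
      Equiv.swap i i' (w (Equiv.swap i i' p)) := fun _ => rfl
  have hvi : (Equiv.swap i i' * w * Equiv.swap i i') i = j' := by grind
  have hvi' : (Equiv.swap i i' * w * Equiv.swap i i') i' = j := by grind
  have hvj : (Equiv.swap i i' * w * Equiv.swap i i') j = i' := by grind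
  have hvj' : (Equiv.swap i i' * w * Equiv.swap i i') j' = i := by grind
  have hvw : ∀ p, p ≠ i → p ≠ i' → p ≠ j → p ≠ j' →
      (Equiv.swap i i' * w * Equiv.swap i i') p = w p := by grind
  clear hσ
  generalize Equiv.swap i i' * w * Equiv.swap i i' = v at hvi hvj hvi' hvj' hvw
  have hv : IsConsistent k m lam mu v := by
    apply isConsistent_of_apply
    · grind
    · intro p hp
      have := @IsConsistent.bitSum_of_lt n k m lam mu w hw p
      have := @IsConsistent.bitSum_of_lt n k m lam mu w hw i
      have := @IsConsistent.bitSum_of_lt n k m lam mu w hw i'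
      grind
  have hc : ∀ a c, _ := arcCount_add_of_eq_off_pair (v := v) (w := w) hi'i.ne' (by grind)
  refine ⟨v, hv, orbit_subset_closure_of_uncross hk hm hlam hmu hv hw hij hi'i hjj' hwi hwi' hvi
    hvj hvw, ?_, ?_⟩
  all_goals
    intro a c hac
    have := hc a c
    grind

end Moves

/-! ### Choosing a move that stays above `v` -/

/-- `v` and `w` agree on the arcs starting to the right of `i`. -/
def ArcsAgreeAfter (v w : Equiv.Perm (Fin n)) (i : Fin n) : Prop :=
  ∀ p, i < p → p < v p ∨ p < w p → v p = w p

theorem exists_last_disagreement {v w : Equiv.Perm (Fin n)} (hv : ∀ p, v (v p) = p)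
    (hw : ∀ p, w (w p) = p) (hne : v ≠ w) :
    ∃ i, v i ≠ w i ∧ (i < v i ∨ i < w i) ∧ ArcsAgreeAfter v w i := by
  classical
  let S : Finset (Fin n) := Finset.univ.filter fun p => v p ≠ w p ∧ (p < v p ∨ p < w p)
  have hmem : ∀ p, p ∈ S ↔ v p ≠ w p ∧ (p < v p ∨ p < w p) := by simp [S]
  have hS : S.Nonempty := by
    obtain ⟨p, hp⟩ : ∃ p, v p ≠ w p := by
      by_contra hc
      push Not at hc
      exact hne (Equiv.ext hc)
    by_cases h : p < v p ∨ p < w p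
    · exact ⟨p, (hmem p).2 ⟨hp, h⟩⟩
    -- If `p` is not a left end for `v` or for `w`, it is a right end for one of them, and the two
    -- involutions also differ at the corresponding left end.
    · rw [not_or, not_lt, not_lt] at h
      rcases lt_or_eq_of_le h.1 with h1 | h1
      · refine ⟨v p, (hmem _).2 ⟨fun h2 => hp ?_, Or.inl (by rwa [hv])⟩⟩
        rw [hv] at h2
        rw [h2, hw, ← h2]
      · have h2 : w p < p := lt_of_le_of_ne h.2 fun h3 => hp (h1.trans h3.symm)
        refine ⟨w p, (hmem _).2 ⟨fun h3 => hp ?_, Or.inr (by rwa [hw])⟩⟩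
        rw [hw] at h3
        rw [← h3, hv, h3]
  refine ⟨S.max' hS, ((hmem _).1 (S.max'_mem hS)).1, ((hmem _).1 (S.max'_mem hS)).2, ?_⟩
  intro p hp h
  by_contra hc
  exact absurd (S.le_max' p ((hmem p).2 ⟨hc, h⟩)) (not_le.2 hp)

/-- The left ends of `v` inside `[a, c]` are also left ends of `w` there: those before `i` have type
0 and fall under `hfull`, those after `i` agree. The node `i` counts only for `w`. -/
theorem arcCount_lt_of_not_lt {lam mu : YoungDiagram} {v w : Equiv.Perm (Fin n)}
    (hv : IsConsistent k m lam mu v) {i a c : Fin n} (hagree : ArcsAgreeAfter v w i)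
    (hvi : ¬ i < v i) (hwi : i < w i) (hai : a ≤ i) (hic : w i ≤ c)
    (hfull : ∀ p, a ≤ p → p < i → bitSum k m lam mu p = 0 → p < w p ∧ w p ≤ c) :
    arcCount v a c < arcCount w a c := by
  rw [← card_arcStarts, ← card_arcStarts]
  refine Finset.card_lt_card ((Finset.ssubset_iff_of_subset fun p hp => ?_).2 ⟨i, ?_, ?_⟩)
  · rw [mem_arcStarts] at hp ⊢
    rcases lt_trichotomy p i with h | rfl | h
    · exact ⟨hp.1, hfull p hp.1 h (hv.bitSum_of_lt hp.2.1).1⟩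
    · exact absurd hp.2.1 hvi
    · rwa [← hagree p h (Or.inl hp.2.1)]
  · exact mem_arcStarts.2 ⟨hai, hwi, hic⟩
  · exact fun h => hvi (mem_arcStarts.1 h).2.1

theorem arcCount_eq_add {w : Equiv.Perm (Fin n)} {a c d : Fin n} (hcd : c ≤ d) :
    arcCount w a d = arcCount w a c +
      (Finset.univ.filter fun p => a ≤ p ∧ p < w p ∧ c < w p ∧ w p ≤ d).card := by
  rw [← card_arcStarts, ← card_arcStarts, ← Finset.card_union_of_disjoint]
  · congr 1
    ext p
    simp only [mem_arcStarts, Finset.mem_union, Finset.mem_filter, Finset.mem_univ, true_and]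
    grind
  · rw [Finset.disjoint_left]
    intro p hp hp'
    simp only [mem_arcStarts, Finset.mem_filter, Finset.mem_univ, true_and] at hp hp'
    grind

/-- The known inequality at the type 2 node `v i` is transported to `c`. Every arc of `w` counted up
to `v i` but not up to `c` is also an arc of `v`, whereas `v` has the further arc from `i` to `v i`;
removing these leaves a strict inequality at `c`, whatever the type of `c`. -/
theorem arcCount_lt_of_lt {v w : Equiv.Perm (Fin n)} {i a c : Fin n}
    (hagree : ArcsAgreeAfter v w i) (hvi : i < v i) (hai : a ≤ i) (hic : w i ≤ c) (hcv : c < v i)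
    (hle : arcCount v a (v i) ≤ arcCount w a (v i))
    (hempty : ∀ p, a ≤ p → p < i → c < w p → ¬ w p ≤ v i) :
    arcCount v a c < arcCount w a c := by
  rw [arcCount_eq_add hcv.le, arcCount_eq_add hcv.le] at hle
  have : (Finset.univ.filter fun p => a ≤ p ∧ p < w p ∧ c < w p ∧ w p ≤ v i).card <
      (Finset.univ.filter fun p => a ≤ p ∧ p < v p ∧ c < v p ∧ v p ≤ v i).card := by
    refine Finset.card_lt_card ((Finset.ssubset_iff_of_subset fun p hp => ?_).2 ⟨i, ?_, ?_⟩)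
    · simp only [Finset.mem_filter, Finset.mem_univ, true_and] at hp ⊢
      rcases lt_trichotomy p i with h | rfl | h
      · exact absurd hp.2.2.2 (hempty p hp.1 h hp.2.2.1)
      · exact absurd hic (not_le.2 hp.2.2.1)
      · rwa [hagree p h (Or.inr hp.2.1)]
    · simp [hai, hvi, hcv]
    · simp [hic]
  omega

/-- On `[i, v i]` the arcs starting after `i` agree, so `w` can match the arc of `v` from `i` only
by one of its own starting at `i`. -/
theorem lt_apply_of_arcCount_le {v w : Equiv.Perm (Fin n)} {i : Fin n} (hne : v i ≠ w i)
    (hagree : ArcsAgreeAfter v w i) (hvi : i < v i)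
    (hle : arcCount v i (v i) ≤ arcCount w i (v i)) : i < w i ∧ w i < v i := by
  by_contra hc
  refine absurd hle (not_le.2 ?_)
  rw [← card_arcStarts, ← card_arcStarts]
  refine Finset.card_lt_card ((Finset.ssubset_iff_of_subset fun p hp => ?_).2 ⟨i, ?_, ?_⟩)
  · rw [mem_arcStarts] at hp ⊢
    rcases lt_or_eq_of_le hp.1 with h | rfl
    · rwa [hagree p h (Or.inr hp.2.1)]
    · exact absurd ⟨hp.2.1, lt_of_le_of_ne hp.2.2 hne.symm⟩ hc
  · exact mem_arcStarts.2 ⟨le_rfl, hvi, le_rfl⟩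
  · intro h
    rw [mem_arcStarts] at h
    exact hc ⟨h.2.1, lt_of_le_of_ne h.2.2 hne.symm⟩

/-- The move acts on the arc of `w` at the last disagreement `i`. If `v` also has an arc there, its
right end lies further right, and the arc of `w` is crossed with an enclosing one ending by `v i`,
or else stretched to `v i`. If `v` has none, the arc is crossed with an enclosing one, or its left
end is moved to a fixed type 0 node, or it is deleted when neither kind of node exists. Taking the
obstructing node `i'` rightmost confines the drop to intervals where `r(v) < r(w)` is forced. -/
theorem exists_degeneration (hk : k ≤ n) (hm : m ≤ n) {lam mu : YoungDiagram}
    (hlam : FitsIn lam k (n - k)) (hmu : FitsIn mu m (n - m)) {v w : Equiv.Perm (Fin n)}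
    (hv : IsConsistent k m lam mu v) (hw : IsConsistent k m lam mu w) (hne : v ≠ w)
    (hle : ∀ a c : Fin n, a < c → bitSum k m lam mu a = 0 → bitSum k m lam mu c = 2 →
      arcCount v a c ≤ arcCount w a c) :
    ∃ u D, IsDegeneration hk hm hlam hmu hw u D ∧ (∃ a c, D a c) ∧
      ∀ a c, bitSum k m lam mu a = 0 → D a c → arcCount v a c < arcCount w a c := by
  classical
  obtain ⟨i, hi, hor, hagree⟩ := exists_last_disagreement hv.apply_apply hw.apply_apply hne
  by_cases hvi : i < v i
  · have hvb := hv.bitSum_of_lt hvi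
    obtain ⟨hwi, hwv⟩ := lt_apply_of_arcCount_le hi hagree hvi (hle _ _ hvi hvb.1 hvb.2)
    let S : Finset (Fin n) := Finset.univ.filter fun p => p < i ∧ w i < w p ∧ w p ≤ v i
    have hmem : ∀ p, p ∈ S ↔ p < i ∧ w i < w p ∧ w p ≤ v i := by simp [S]
    by_cases hS : S.Nonempty
    · have hmax := (hmem _).1 (S.max'_mem hS)
      have hgt : ∀ p ∈ S, p ≤ S.max' hS := fun p hp => S.le_max' p hp
      generalize S.max' hS = i' at hmax hgt
      obtain ⟨u, hu⟩ := exists_degeneration_uncross hk hm hlam hmu hw hwi hmax.1 hmax.2.1 rfl rfl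
      refine ⟨u, _, hu, ⟨i, w i, hmax.1, le_rfl, le_rfl, hmax.2.1⟩, ?_⟩
      rintro a c ha ⟨h1, h2, h3, h4⟩
      refine arcCount_lt_of_lt hagree hvi h2 h3 (h4.trans_le hmax.2.2)
        (hle a (v i) (h2.trans_lt hvi) ha hvb.2) fun p hp1 hp2 hp3 hp4 => ?_
      exact absurd (hgt p ((hmem p).2 ⟨hp2, h3.trans_lt hp3, hp4⟩)) (not_le.2 (h1.trans_le hp1))
    · have hno : ∀ p, p < i → w i < w p → ¬ w p ≤ v i := fun p h1 h2 h3 =>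
        hS ⟨p, (hmem p).2 ⟨h1, h2, h3⟩⟩
      -- The node `v i` has type 2, so it is not a left end. An arc of `w` ending there cannot start
      -- before `i` (by `hno`), at `i` (where `v` and `w` differ) or after `i` (where they agree).
      have hfix : w (v i) = v i := by
        rcases lt_trichotomy (w (v i)) (v i) with h | h | h
        · exfalso
          have hww := hw.apply_apply (v i)
          rcases lt_trichotomy (w (v i)) i with h' | h' | h'
          · exact hno _ h' (by rwa [hww]) (by rw [hww])
          · rw [h'] at hww
            exact hi hww.symm
          · have := hagree _ h' (Or.inr (by rwa [hww]))
            rw [hww] at this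
            exact h'.ne' (v.injective this)
        · exact h
        · have := (hw.bitSum_of_lt h).1
          omega
      obtain ⟨u, hu⟩ := exists_degeneration_move_right hk hm hlam hmu hw hwi hwv hvb.2 rfl hfix
      refine ⟨u, _, hu, ⟨i, w i, le_rfl, le_rfl, hwv⟩, ?_⟩
      rintro a c ha ⟨h2, h3, h4⟩
      exact arcCount_lt_of_lt hagree hvi h2 h3 h4
        (hle a (v i) (h2.trans_lt hvi) ha hvb.2) fun p _ hp2 hp3 => hno p hp2 (h3.trans_lt hp3)
  · have hwi : i < w i := hor.resolve_left hvi
    let S : Finset (Fin n) := Finset.univ.filter fun p =>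
      p < i ∧ bitSum k m lam mu p = 0 ∧ (p < w p → w i < w p)
    have hmem : ∀ p, p ∈ S ↔ p < i ∧ bitSum k m lam mu p = 0 ∧ (p < w p → w i < w p) := by
      simp [S]
    have hfull : ∀ p, p < i → p ∉ S → bitSum k m lam mu p = 0 → p < w p ∧ w p ≤ w i := by
      intro p h1 h2 h3
      rw [hmem] at h2
      grind
    by_cases hS : S.Nonempty
    · have hmax := (hmem _).1 (S.max'_mem hS)
      have hgt : ∀ p ∈ S, p ≤ S.max' hS := fun p hp => S.le_max' p hp
      generalize S.max' hS = i' at hmax hgt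
      have hlt : ∀ a c, i' < a → a ≤ i → w i ≤ c → arcCount v a c < arcCount w a c := by
        intro a c h1 h2 h3
        refine arcCount_lt_of_not_lt hv hagree hvi hwi h2 h3 fun p hp1 hp2 hp3 => ?_
        have := hfull p hp2 (fun h => absurd (hgt p h) (not_le.2 (h1.trans_le hp1))) hp3
        exact ⟨this.1, this.2.trans h3⟩
      by_cases hi' : i' < w i'
      · obtain ⟨u, hu⟩ := exists_degeneration_uncross hk hm hlam hmu hw hwi hmax.1
          (hmax.2.2 hi') rfl rfl
        refine ⟨u, _, hu, ⟨i, w i, hmax.1, le_rfl, le_rfl, hmax.2.2 hi'⟩, ?_⟩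
        rintro a c - ⟨h1, h2, h3, -⟩
        exact hlt a c h1 h2 h3
      · have hfix : w i' = i' := by
          refine le_antisymm (not_lt.1 hi') (not_lt.1 fun h => ?_)
          have := (hw.bitSum_of_gt h).2
          omega
        obtain ⟨u, hu⟩ := exists_degeneration_move_up hk hm hlam hmu hw hwi hmax.1 hmax.2.1
          rfl hfix
        refine ⟨u, _, hu, ⟨i, w i, hmax.1, le_rfl, le_rfl⟩, ?_⟩
        rintro a c - ⟨h1, h2, h3⟩
        exact hlt a c h1 h2 h3
    · obtain ⟨u, hu⟩ := exists_degeneration_remove hk hm hlam hmu hw hwi rfl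
      refine ⟨u, _, hu, ⟨i, w i, le_rfl, le_rfl⟩, ?_⟩
      rintro a c - ⟨h2, h3⟩
      refine arcCount_lt_of_not_lt hv hagree hvi hwi h2 h3 fun p _ hp2 hp3 => ?_
      have := hfull p hp2 (fun h => hS ⟨p, h⟩) hp3
      exact ⟨this.1, this.2.trans h3⟩

theorem orbit_subset_closure_of_arcCount_le (hk : k ≤ n) (hm : m ≤ n) {lam mu : YoungDiagram}
    (hlam : FitsIn lam k (n - k)) (hmu : FitsIn mu m (n - m)) {v w : Equiv.Perm (Fin n)}
    (hv : IsConsistent k m lam mu v) (hw : IsConsistent k m lam mu w)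
    (hle : ∀ a c : Fin n, a < c → bitSum k m lam mu a = 0 → bitSum k m lam mu c = 2 →
      arcCount v a c ≤ arcCount w a c) :
    orbit hk hm hlam hmu hv ⊆ closure (orbit hk hm hlam hmu hw) := by
  -- The sum runs over all intervals, not only those with ends of types 0 and 2, so every move makes
  -- it strictly smaller.
  induction hN : ∑ a, ∑ c, arcCount w a c using Nat.strong_induction_on generalizing w with
  | _ N ih =>
    by_cases hne : v = w
    · subst hne
      exact subset_closure
    obtain ⟨u, D, hu, ⟨a₀, c₀, hD⟩, hlt⟩ := exists_degeneration hk hm hlam hmu hv hw hne hle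
    have huw : ∀ a c, arcCount u a c ≤ arcCount w a c := by
      intro a c
      by_cases h : D a c
      · have := hu.arcCount_of_mem a c h
        omega
      · exact (hu.arcCount_of_notMem a c h).le
    have hsum : ∑ a, ∑ c, arcCount u a c < N := by
      rw [← hN]
      refine Finset.sum_lt_sum (fun a _ => Finset.sum_le_sum fun c _ => huw a c)
        ⟨a₀, Finset.mem_univ _, Finset.sum_lt_sum (fun c _ => huw a₀ c)
          ⟨c₀, Finset.mem_univ _, ?_⟩⟩
      have := hu.arcCount_of_mem a₀ c₀ hD
      omega
    refine (ih _ hsum hu.consistent ?_ rfl).trans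
      (closure_minimal hu.subset_closure isClosed_closure)
    intro a c hac ha hc
    by_cases h : D a c
    · have := hu.arcCount_of_mem a c h
      have := hlt a c ha h
      omega
    · rw [hu.arcCount_of_notMem a c h]
      exact hle a c hac ha hc

/-! ### The closed, Borel-invariant conditions behind `r_ij` -/

/-- The linear map measuring how far `(u, x)` is from satisfying `u, x ∈ ⟨e_1, …, e_j⟩` and
`u + x ∈ ⟨e_1, …, e_{i-1}⟩`. -/
def intervalMap (i j : Fin n) :
    (Fin n → ℂ) × (Fin n → ℂ) →ₗ[ℂ] (Fin n → ℂ) × (Fin n → ℂ) × (Fin n → ℂ) where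
  toFun y := (fun p => if j < p then y.1 p else 0, fun p => if j < p then y.2 p else 0,
    fun p => if i ≤ p then y.1 p + y.2 p else 0)
  map_add' y z := by
    ext p <;> simp only [Prod.fst_add, Prod.snd_add, Pi.add_apply] <;> split_ifs <;> ring
  map_smul' c y := by
    ext p <;> simp [mul_add]

theorem mem_ker_intervalMap {i j : Fin n} {y : (Fin n → ℂ) × (Fin n → ℂ)} :
    y ∈ LinearMap.ker (intervalMap i j) ↔
      (∀ p, j < p → y.1 p = 0) ∧ (∀ p, j < p → y.2 p = 0) ∧ ∀ p, i ≤ p → y.1 p + y.2 p = 0 := by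
  simp only [LinearMap.mem_ker, intervalMap, LinearMap.coe_mk, AddHom.coe_mk, Prod.mk_eq_zero,
    funext_iff, Pi.zero_apply, ite_eq_right_iff]

/-- The dimension of the space of pairs in `U × W` annihilated by `intervalMap`. -/
def intervalCorank (i j : Fin n) (P : DoubleGr n k m) : ℕ :=
  Module.finrank ℂ (P.U.prod P.W ⊓ LinearMap.ker (intervalMap i j) :
    Submodule ℂ ((Fin n → ℂ) × (Fin n → ℂ)))

theorem finrank_map_add_intervalCorank (i j : Fin n) (P : DoubleGr n k m) :
    Module.finrank ℂ ((P.U.prod P.W).map (intervalMap i j)) + intervalCorank i j P = k + m := by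
  have h := LinearMap.finrank_range_add_finrank_ker
    ((intervalMap i j).comp (P.U.prod P.W).subtype)
  rw [LinearMap.range_comp, Submodule.range_subtype, LinearMap.ker_comp,
    ← Submodule.finrank_map_subtype_eq, Submodule.map_comap_subtype] at h
  have hinj : Function.Injective (P.U.subtype.prodMap P.W.subtype) := by
    rw [LinearMap.coe_prodMap]
    exact P.U.injective_subtype.prodMap P.W.injective_subtype
  have hprod : Module.finrank ℂ (P.U.prod P.W) = k + m := by
    have := LinearMap.finrank_range_of_inj hinj
    rwa [LinearMap.range_prodMap, Submodule.range_subtype, Submodule.range_subtype,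
      Module.finrank_prod, P.finrank_U, P.finrank_W] at this
  rw [intervalCorank, h, hprod]

theorem isClosed_le_intervalCorank (i j : Fin n) (r : ℕ) :
    IsClosed {P : DoubleGr n k m | r ≤ intervalCorank i j P} := by
  by_cases hr : r ≤ k + m
  · convert isClosed_finrank_map_le (n := n) (k := k) (m := m) (intervalMap i j) (k + m - r)
      using 3 with P
    have := finrank_map_add_intervalCorank i j P
    omega
  -- For `r > k + m` the subtraction `k + m - r` would truncate, but the set is then empty.
  · convert isClosed_empty
    ext P
    have := finrank_map_add_intervalCorank i j P
    simp only [Set.mem_ofPred_eq, Set.mem_empty_iff_false, iff_false]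
    omega

/-- Upper triangular matrices preserve the flag `⟨e_1, …, e_j⟩`, hence the kernel of `intervalMap`.
-/
theorem intervalCorank_of_mem_borelOrbit (i j : Fin n) {P Q : DoubleGr n k m}
    (h : Q ∈ borelOrbit P) : intervalCorank i j Q = intervalCorank i j P := by
  obtain ⟨g, hg, hU, hW⟩ := h
  have hg' : ∀ p q : Fin n, q < p → g.1 p q = 0 := fun p q hqp => hg hqp
  have hinj : Function.Injective (toLin' g.1) :=
    mulVec_injective_of_isUnit g.isUnit
  set G : (Fin n → ℂ) × (Fin n → ℂ) →ₗ[ℂ] (Fin n → ℂ) × (Fin n → ℂ) :=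
    (toLin' g.1).prodMap (toLin' g.1) with hG
  have hGinj : Function.Injective G := by
    rw [hG, LinearMap.coe_prodMap]
    exact hinj.prodMap hinj
  have hker : (LinearMap.ker (intervalMap i j)).map G = LinearMap.ker (intervalMap i j) := by
    apply Submodule.eq_of_le_of_finrank_eq
    · rintro _ ⟨y, hy, rfl⟩
      rw [SetLike.mem_coe, mem_ker_intervalMap] at hy
      obtain ⟨h1, h2, h3⟩ := hy
      have hz : ∀ (x : Fin n → ℂ) (a : Fin n), (∀ q, a ≤ q → x q = 0) →
          (g.1 *ᵥ x) a = 0 := by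
        intro x a hx
        simp only [mulVec, dotProduct]
        refine Finset.sum_eq_zero fun q _ => ?_
        rcases lt_or_ge q a with hq | hq
        · rw [hg' a q hq, zero_mul]
        · rw [hx q hq, mul_zero]
      rw [mem_ker_intervalMap]
      refine ⟨fun p hp => hz _ _ fun q hq => h1 q (hp.trans_le hq),
        fun p hp => hz _ _ fun q hq => h2 q (hp.trans_le hq), fun p hp => ?_⟩
      have := hz (y.1 + y.2) p fun q hq => h3 q (hp.trans hq)
      rwa [mulVec_add] at this
    · exact (Submodule.equivMapOfInjective G hGinj _).finrank_eq.symm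
  have hprod : Q.U.prod Q.W = (P.U.prod P.W).map G := by
    rw [hU, hW, hG, LinearMap.prodMap_map_prod]
  unfold intervalCorank
  rw [hprod, ← hker, ← Submodule.map_inf G hGinj, hker]
  exact (Submodule.equivMapOfInjective G hGinj _).finrank_eq.symm

theorem apply_of_mem_repU {lam mu : YoungDiagram} {w : Equiv.Perm (Fin n)}
    (hw : IsConsistent k m lam mu w) {u : Fin n → ℂ} (hu : u ∈ repU k lam w) {z : Fin n}
    (hz : bit k lam z ≠ 1) : u z = if z < w z then u (w z) else 0 := by
  rw [repU_eq_map hw] at hu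
  obtain ⟨a, ha, rfl⟩ := hu
  rw [SetLike.mem_coe, mem_repW_iff] at ha
  have hN : ∀ q, (arcMatrix w *ᵥ a) q = if q < w q then a (w q) else 0 := by
    intro q
    have h1 : ∀ p, arcMatrix w q p = if p = w q ∧ q < w q then 1 else 0 := by
      intro p
      simp only [arcMatrix, of_apply]
      have := hw.apply_apply
      congr 1
      grind
    simp only [mulVec, dotProduct, h1]
    by_cases hq : q < w q <;> simp [hq]
  simp only [toLin'_apply, add_mulVec, one_mulVec, Pi.add_apply, hN, ha z hz, zero_add,
    hw.apply_apply]
  split_ifs with h h' <;> first | rfl | simp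

/-- The vector of `repU` with leading term `e p`. -/
def repUVec (w : Equiv.Perm (Fin n)) (p : Fin n) : Fin n → ℂ :=
  e p + if w p < p then e (w p) else 0

theorem repUVec_mem {lam mu : YoungDiagram} {w : Equiv.Perm (Fin n)}
    (hw : IsConsistent k m lam mu w) {p : Fin n} (hp : bit k lam p = 1) :
    repUVec w p ∈ repU k lam w := by
  rw [repU_eq_map hw]
  refine ⟨e p, Submodule.subset_span ⟨p, hp, rfl⟩, ?_⟩
  rw [toLin'_apply, add_mulVec, one_mulVec, arcMatrix_mulVec_e, repUVec]

theorem e_apply (p q : Fin n) : (e p : Fin n → ℂ) q = if q = p then 1 else 0 := by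
  simp [e, Pi.single_apply]

theorem repUVec_apply {w : Equiv.Perm (Fin n)} (p q : Fin n) :
    repUVec w p q = if q = p then 1 else if w p < p ∧ q = w p then 1 else 0 := by
  unfold repUVec
  rw [Pi.add_apply]
  by_cases h : w p < p
  · simp only [h, if_true, e_apply, true_and]
    by_cases hq : q = p
    · subst hq
      simp [h.ne']
    · simp [hq]
  · simp [h, e_apply]

theorem repUVec_apply_of_bit {lam mu : YoungDiagram} {w : Equiv.Perm (Fin n)}
    (hw : IsConsistent k m lam mu w) (p : Fin n) {q : Fin n} (hq : bit k lam q = 1) :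
    repUVec w p q = if q = p then 1 else 0 := by
  rw [repUVec_apply]
  congr 1
  refine if_neg ?_
  rintro ⟨h, rfl⟩
  have := (hw.bitSum_of_gt h).1
  unfold bitSum at this
  omega

/-- The nodes in `[i, j]` with `s = 2` which are not the end of an arc inside `[i, j]`. -/
def freeNodes (k m : ℕ) (lam mu : YoungDiagram) (w : Equiv.Perm (Fin n)) (i j : Fin n) :
    Finset (Fin n) :=
  Finset.univ.filter fun y =>
    (bitSum k m lam mu y = 2 ∧ i ≤ y ∧ y ≤ j) ∧ ¬ (i ≤ w y ∧ w y < y)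

theorem mem_freeNodes {lam mu : YoungDiagram} {w : Equiv.Perm (Fin n)} {i j y : Fin n} :
    y ∈ freeNodes k m lam mu w i j ↔
      (bitSum k m lam mu y = 2 ∧ i ≤ y ∧ y ≤ j) ∧ ¬ (i ≤ w y ∧ w y < y) := by
  simp [freeNodes]

/-- An arc inside `[i, j]` is determined by its right end, a type 2 node; the remaining type 2 nodes
are the free ones. -/
theorem card_freeNodes_add_arcCount {lam mu : YoungDiagram} {w : Equiv.Perm (Fin n)}
    (hw : IsConsistent k m lam mu w) (i j : Fin n) :
    (freeNodes k m lam mu w i j).card + arcCount w i j =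
      (Finset.univ.filter fun y : Fin n => bitSum k m lam mu y = 2 ∧ i ≤ y ∧ y ≤ j).card := by
  have hww := hw.apply_apply
  rw [← Finset.card_filter_add_card_filter_not
      (s := Finset.univ.filter fun y : Fin n => bitSum k m lam mu y = 2 ∧ i ≤ y ∧ y ≤ j)
      (fun y => i ≤ w y ∧ w y < y), add_comm,
    ← card_arcStarts, freeNodes, Finset.filter_filter, Finset.filter_filter]
  congr 1
  refine Finset.card_bij (fun p _ => w p) ?_ (fun p _ q _ h => w.injective h) ?_
  · intro p hp
    rw [mem_arcStarts] at hp
    have := (hw.bitSum_of_lt hp.2.1).2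
    simp only [Finset.mem_filter, Finset.mem_univ, true_and, hww]
    exact ⟨⟨this, hp.1.trans hp.2.1.le, hp.2.2⟩, hp.1, hp.2.1⟩
  · intro y hy
    simp only [Finset.mem_filter, Finset.mem_univ, true_and] at hy
    exact ⟨w y, mem_arcStarts.2 ⟨hy.2.1, by rw [hww]; exact hy.2.2, by rw [hww]; exact hy.1.2.2⟩,
      hww y⟩

theorem finrank_eq_card_of_dual {V ι : Type*} [AddCommGroup V] [Module ℂ V] [Fintype ι]
    [FiniteDimensional ℂ V] [DecidableEq ι]
    (φ : V →ₗ[ℂ] ι → ℂ) (S : Submodule ℂ V) (hinj : ∀ x ∈ S, φ x = 0 → x = 0)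
    (b : ι → V) (hb : ∀ a, b a ∈ S) (hφ : ∀ a, φ (b a) = Pi.single a 1) :
    Module.finrank ℂ S = Fintype.card ι := by
  apply le_antisymm
  · have : Function.Injective (φ.domRestrict S) := by
      rw [← LinearMap.ker_eq_bot, LinearMap.ker_eq_bot']
      intro x hx
      exact Subtype.ext (hinj x x.2 hx)
    simpa using LinearMap.finrank_le_finrank_of_injective this
  · have : LinearIndependent ℂ fun a => (⟨b a, hb a⟩ : S) := by
      apply LinearIndependent.of_comp (φ.domRestrict S)
      have : (φ.domRestrict S ∘ fun a => (⟨b a, hb a⟩ : S)) = fun a => Pi.single a 1 := by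
        ext1 a
        exact hφ a
      rw [this]
      exact Pi.linearIndependent_single_one ι ℂ
    exact this.fintype_card_le_finrank

/-- The coordinates on the pairs in `repU × repW` annihilated by `intervalMap`. -/
def intervalCoord (lam mu : YoungDiagram) (k m : ℕ) (w : Equiv.Perm (Fin n)) (i j : Fin n) :
    (Fin n → ℂ) × (Fin n → ℂ) →ₗ[ℂ]
      ({p : Fin n // bit k lam p = 1 ∧ p < i} ⊕ {p : Fin n // bit m mu p = 1 ∧ p < i} ⊕
        {p // p ∈ freeNodes k m lam mu w i j}) → ℂ where
  toFun y := Sum.elim (fun p => y.1 p) (Sum.elim (fun p => y.2 p) fun p => y.1 p)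
  map_add' y z := by ext (a | a | a) <;> rfl
  map_smul' c y := by ext (a | a | a) <;> rfl

/-- A basis consists of the vectors of `U` and of `W` with leading node before `i`, taken
separately, and one pair `(u, -e_p)` for each free node `p`. The vector `u` is `e_p` plus at most
one basis vector with index below `i`, so the two cancel from `i` on. -/
theorem intervalCorank_canonicalPair (hk : k ≤ n) (hm : m ≤ n) {lam mu : YoungDiagram}
    (hlam : FitsIn lam k (n - k)) (hmu : FitsIn mu m (n - m)) {w : Equiv.Perm (Fin n)}
    (hw : IsConsistent k m lam mu w) {i j : Fin n} (hij : i ≤ j) :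
    intervalCorank i j (canonicalPair hk hm hlam hmu hw) =
      Fintype.card {p : Fin n // bit k lam p = 1 ∧ p < i} +
      (Fintype.card {p : Fin n // bit m mu p = 1 ∧ p < i} +
        (freeNodes k m lam mu w i j).card) := by
  classical
  have hb2 : ∀ {p : Fin n}, bitSum k m lam mu p = 2 → bit k lam p = 1 ∧ bit m mu p = 1 := by
    intro p hp
    have := bit_le_one (k := k) lam p
    have := bit_le_one (k := m) mu p
    unfold bitSum at hp
    omega
  unfold intervalCorank
  rw [finrank_eq_card_of_dual (intervalCoord lam mu k m w i j) _ ?_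
    (Sum.elim (fun p => (repUVec w p, 0)) (Sum.elim (fun p => (0, e p))
      fun p => (repUVec w p, - e p))) ?_ ?_]
  · simp
  · rintro ⟨u, x⟩ ⟨⟨hu, hx⟩, hker⟩ h0
    change u ∈ repU k lam w at hu
    change x ∈ repW m mu at hx
    rw [mem_repW_iff] at hx
    rw [SetLike.mem_coe, mem_ker_intervalMap] at hker
    obtain ⟨k1, k2, k3⟩ := hker
    simp only at k1 k2 k3
    have c1 : ∀ p, bit k lam p = 1 → p < i → u p = 0 := fun p hp hpi =>
      congrFun h0 (Sum.inl ⟨p, hp, hpi⟩)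
    have c2 : ∀ p, bit m mu p = 1 → p < i → x p = 0 := fun p hp hpi =>
      congrFun h0 (Sum.inr (Sum.inl ⟨p, hp, hpi⟩))
    have c3 : ∀ p, p ∈ freeNodes k m lam mu w i j → u p = 0 := fun p hp =>
      congrFun h0 (Sum.inr (Sum.inr ⟨p, hp⟩))
    have hu1 : ∀ p, bit k lam p = 1 → u p = 0 := by
      intro p hp
      rcases lt_or_ge p i with hpi | hpi
      · exact c1 p hp hpi
      rcases lt_or_ge j p with hpj | hpj
      · exact k1 p hpj
      by_cases hpm : bit m mu p = 1
      · by_cases hfree : p ∈ freeNodes k m lam mu w i j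
        · exact c3 p hfree
        · rw [mem_freeNodes, not_and, not_not] at hfree
          -- If `p` ends an arc inside `[i, j]`, then `u` has the same coordinate at `p` and at `w
          -- p`. As `w p` has type 0, `x` vanishes there, and the condition on `u + x` makes this
          -- coordinate zero.
          obtain ⟨h1, h2⟩ := hfree ⟨by unfold bitSum; omega, hpi, hpj⟩
          have hz := (hw.bitSum_of_gt h2).1
          unfold bitSum at hz
          have h3 := apply_of_mem_repU hw hu (z := w p) (by omega)
          rw [hw.apply_apply, if_pos h2] at h3
          have h4 := k3 (w p) h1
          rw [hx (w p) (by omega), add_zero] at h4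
          rw [← h3, h4]
      · have := k3 p hpi
        rwa [hx p hpm, add_zero] at this
    have hu0 : u = 0 := by
      ext z
      by_cases hz : bit k lam z = 1
      · exact hu1 z hz
      · rw [apply_of_mem_repU hw hu hz]
        split_ifs with h
        · exact hu1 _ (hb2 (hw.bitSum_of_lt h).2).1
        · rfl
    have hx0 : x = 0 := by
      ext p
      by_cases hp : bit m mu p = 1
      · rcases lt_or_ge p i with hpi | hpi
        · exact c2 p hp hpi
        · have := k3 p hpi
          rwa [hu0, Pi.zero_apply, zero_add] at this
      · exact hx p hp
    rw [hu0, hx0]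
    rfl
  · have hlow : ∀ p q : Fin n, p < q → repUVec w p q = 0 := by
      intro p q hpq
      rw [repUVec_apply, if_neg hpq.ne', if_neg]
      rintro ⟨h, rfl⟩
      exact absurd hpq h.not_gt
    have hel : ∀ p q : Fin n, p < q → (e p : Fin n → ℂ) q = 0 := by
      intro p q hpq
      rw [e_apply, if_neg hpq.ne']
    rintro (⟨p, hp, hpi⟩ | ⟨p, hp, hpi⟩ | ⟨p, hp⟩)
    · refine ⟨⟨repUVec_mem hw hp, zero_mem _⟩, mem_ker_intervalMap.2 ⟨?_, ?_, ?_⟩⟩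
      · exact fun q hq => hlow p q ((hpi.trans_le hij).trans hq)
      · exact fun q hq => rfl
      · intro q hq
        simp [hlow p q (hpi.trans_le hq)]
    · refine ⟨⟨zero_mem _, Submodule.subset_span ⟨p, hp, rfl⟩⟩, mem_ker_intervalMap.2 ⟨?_, ?_, ?_⟩⟩
      · exact fun q hq => rfl
      · exact fun q hq => hel p q ((hpi.trans_le hij).trans hq)
      · intro q hq
        simp [hel p q (hpi.trans_le hq)]
    · rw [mem_freeNodes] at hp
      obtain ⟨⟨h2, hpi, hpj⟩, hfree⟩ := hp
      refine ⟨⟨repUVec_mem hw (hb2 h2).1, neg_mem (Submodule.subset_span ⟨p, (hb2 h2).2, rfl⟩)⟩,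
        mem_ker_intervalMap.2 ⟨?_, ?_, ?_⟩⟩
      · exact fun q hq => hlow p q (hpj.trans_lt hq)
      · intro q hq
        simp [hel p q (hpj.trans_lt hq)]
      · intro q hq
        simp only [Sum.elim_inr, Pi.neg_apply, repUVec_apply, e_apply]
        by_cases hqp : q = p
        · simp [hqp]
        · have : ¬ (w p < p ∧ q = w p) := by
            rintro ⟨h3, rfl⟩
            exact hfree ⟨hq, h3⟩
          simp [hqp, this]
  · rintro (⟨p, hp, hpi⟩ | ⟨p, hp, hpi⟩ | ⟨p, hp⟩) <;> ext (⟨q, hq, hqi⟩ | ⟨q, hq, hqi⟩ | ⟨q, hq⟩)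
    all_goals
      -- Distinctness of the index blocks: a free node has type 2, so `repUVec` is dual at it, and
      -- it is at least `i`, unlike the nodes of the other two blocks.
      first
        | have hqb := (hb2 (mem_freeNodes.1 hq).1.1).1
          have hqi' := (mem_freeNodes.1 hq).1.2.1
        | skip
      first
        | have hpi' := (mem_freeNodes.1 hp).1.2.1
        | skip
      simp only [intervalCoord, LinearMap.coe_mk, AddHom.coe_mk, Sum.elim_inl, Sum.elim_inr,
        Pi.zero_apply, Pi.neg_apply, e_apply, Pi.single_apply, Sum.inl.injEq, Sum.inr.injEq,
        Subtype.mk.injEq, reduceCtorEq, if_false]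
      try simp only [repUVec_apply_of_bit hw _ hq]
      try simp only [repUVec_apply_of_bit hw _ hqb]
      try grind

/-- Only the number of free nodes in the corank depends on the involution, and a larger number of
free nodes means fewer arcs. The types of `i` and `j` play no role in this direction. -/
theorem arcCount_le_of_orbit_subset_closure (hk : k ≤ n) (hm : m ≤ n) {lam mu : YoungDiagram}
    (hlam : FitsIn lam k (n - k)) (hmu : FitsIn mu m (n - m)) {v w : Equiv.Perm (Fin n)}
    (hv : IsConsistent k m lam mu v) (hw : IsConsistent k m lam mu w)
    (h : orbit hk hm hlam hmu hv ⊆ closure (orbit hk hm hlam hmu hw)) {i j : Fin n}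
    (hij : i ≤ j) : arcCount v i j ≤ arcCount w i j := by
  have hmem : canonicalPair hk hm hlam hmu hv ∈ orbit hk hm hlam hmu hv :=
    ⟨1, one_mem _, by simp, by simp⟩
  have hsub : orbit hk hm hlam hmu hw ⊆ {P : DoubleGr n k m |
      intervalCorank i j (canonicalPair hk hm hlam hmu hw) ≤ intervalCorank i j P} :=
    fun P hP => (intervalCorank_of_mem_borelOrbit i j hP).ge
  have hle := closure_minimal hsub (isClosed_le_intervalCorank i j _) (h hmem)
  rw [Set.mem_ofPred_eq, intervalCorank_canonicalPair hk hm hlam hmu hv hij,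
    intervalCorank_canonicalPair hk hm hlam hmu hw hij] at hle
  have h1 := card_freeNodes_add_arcCount hv i j
  have h2 := card_freeNodes_add_arcCount hw i j
  omega

end DoubleGrassmannian

end

theorem mainTheorem2 (n k m : ℕ) (hk : k ≤ n) (hm : m ≤ n) (lam mu : YoungDiagram)
    (hlam : DoubleGrassmannian.FitsIn lam k (n - k))
    (hmu : DoubleGrassmannian.FitsIn mu m (n - m))
    (v w : Equiv.Perm (Fin n))
    (hv : DoubleGrassmannian.IsConsistent k m lam mu v)
    (hw : DoubleGrassmannian.IsConsistent k m lam mu w) :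
    DoubleGrassmannian.orbit hk hm hlam hmu hv ⊆
        closure (DoubleGrassmannian.orbit hk hm hlam hmu hw) ↔
      ∀ i j : Fin n, i < j →
        DoubleGrassmannian.bitSum k m lam mu i = 0 →
        DoubleGrassmannian.bitSum k m lam mu j = 2 →
        DoubleGrassmannian.arcCount v i j ≤ DoubleGrassmannian.arcCount w i j :=
  ⟨fun h _ _ hij _ _ => DoubleGrassmannian.arcCount_le_of_orbit_subset_closure hk hm hlam hmu hv hw h
      hij.le,
    DoubleGrassmannian.orbit_subset_closure_of_arcCount_le hk hm hlam hmu hv hw⟩
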